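/- Conventions. A tabular MDP with $S$ states and $A$ actions consists of a (deterministic) reward $r(s,a)\in[0,1]$ and a transition law $p(\cdot\mid s,a)$ for every state $s$ and action $a$. Its diameter is $\max_{s\neq s'}\min_{\pi}\mathbb{E}[\tau_\pi(s\to s')]$, where $\pi$ ranges over the stationary deterministic policies and $\tau_\pi(s\to s')$ is the first time at which the chain of $\pi$ started in $s$ is in $s'$; its optimal average reward $\rho^*$ is the largest long-run average reward of a stationary deterministic policy (it does not depend on the initial state when the diameter is finite). A nonstationary MDP is a sequence $M_t=(r_t,p_t)$, $t=1,2,\dots$, of tabular MDPs on the same $S$ states and $A$ actions, $M_t$ being in force at step $t$. An algorithm chooses its action $a_t$ at step $t$, possibly at random, from the past states, actions and rewards and the current state $s_t$, and then receives $r_t(s_t,a_t)$ and moves to $s_{t+1}\sim p_t(\cdot\mid s_t,a_t)$. Its dynamic regret over $T$ steps is $$\text{Dyn-Reg}(T)=\sum_{t=1}^{T}\bigl(\rho^*_t-\mathbb{E}[r_t(s_t,a_t)]\bigr),$$ where $\rho_t^*$ is the optimal average reward of $M_t$. Corollary. There is an absolute constant $c>0$ such that the following holds for all integers $S\ge 2$,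 $A\ge 2$, $T$ and all real $D\ge 20\max\{1,\log_A S\}$ and $B\ge 0$ with $T\ge DSA$ and $T\ge BD^2SA$. For every algorithm (which may depend on $S,A,D,B,T$) and every initial state $s_1$ there is a nonstationary MDP with $S$ states and $A$ actions such that every $M_t$ has diameter $D$, the rewards do not change over the steps $1,\dots,T$, the transitions satisfy the variation budget $$\sum_{t=1}^{T-1}\max_{s,a}\bigl\|p_{t+1}(\cdot\mid s,a)-p_t(\cdot\mid s,a)\bigr\|_1\le B,$$ and the dynamic regret of the algorithm started in $s_1$ satisfies $$\text{Dyn-Reg}(T)\ \ge\ c\,D^{2/3}B^{1/3}S^{1/3}A^{1/3}T^{2/3}.$$ -/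

import Mathlib

open scoped ENNReal

noncomputable section

/-- A tabular Markov decision process with states `Fin S` and actions `Fin A`, rewards in
`[0, 1]`, and transition kernel `trans s a`, the law of the next state. -/
structure TabularMDP (S A : ℕ) where
  reward : Fin S → Fin A → ℝ
  reward_mem : ∀ s a, reward s a ∈ Set.Icc (0 : ℝ) 1
  trans : Fin S → Fin A → PMF (Fin S)

namespace TabularMDP

variable {S A : ℕ}

/-- The law of the state after `n` steps, starting in `s` and following the stationary
deterministic policy `π`. -/
def stateLaw (M : TabularMDP S A) (π : Fin S → Fin A) (s : Fin S) : ℕ → PMF (Fin S)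
  | 0 => PMF.pure s
  | n + 1 => (stateLaw M π s n).bind fun u => M.trans u (π u)

/-- The long-run average reward of the stationary policy `π` from the state `s`. For a finite
chain the averages converge, so that the lower limit is the limit. -/
def gain (M : TabularMDP S A) (π : Fin S → Fin A) (s : Fin S) : ℝ :=
  Filter.liminf (fun n : ℕ =>
    (∑ k ∈ Finset.range n, ∑ u, (M.stateLaw π s k u).toReal * M.reward u (π u)) / (n : ℝ))
    Filter.atTop

/-- The optimal long-run average reward from the state `s`. It does not depend on `s` when the
diameter is finite. -/
def optimalGain (M : TabularMDP S A) (s : Fin S) : ℝ :=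
  ⨆ π : Fin S → Fin A, M.gain π s

/-- The probability that the chain of the policy `π`, started in `x`, does not visit `y` at any
of the times `0, …, n`. -/
def survival (M : TabularMDP S A) (π : Fin S → Fin A) (y : Fin S) : ℕ → Fin S → ℝ≥0∞
  | 0, x => if x = y then 0 else 1
  | n + 1, x => if x = y then 0 else ∑ u, M.trans x (π x) u * survival M π y n u

/-- The expected first time at which the chain of the policy `π`, started in `x`, is in `y`,
written as the sum over `n` of the probability that this time exceeds `n`. -/
def hittingTime (M : TabularMDP S A) (π : Fin S → Fin A) (x y : Fin S) : ℝ≥0∞ :=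
  ∑' n : ℕ, M.survival π y n x

/-- The diameter: the largest, over ordered pairs of distinct states, of the least expected time
that a stationary policy needs to get from the first to the second. -/
def diameter (M : TabularMDP S A) : ℝ≥0∞ :=
  ⨆ (x : Fin S) (y : Fin S) (_ : x ≠ y), ⨅ π : Fin S → Fin A, M.hittingTime π x y

end TabularMDP

/-- A nonstationary tabular MDP: the process `M t` is in force at the step `t = 0, 1, 2, …`. -/
abbrev NonstationaryMDP (S A : ℕ) := ℕ → TabularMDP S A

/-- A (randomized, history-dependent) learning algorithm: at the step `t` it sees the states,
actions and rewards of the steps before `t` and the current state, and it chooses the law of its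
action. -/
abbrev LearningAlgorithm (S A : ℕ) :=
  (t : ℕ) → (Fin t → Fin S × Fin A × ℝ) → Fin S → PMF (Fin A)

namespace NonstationaryMDP

variable {S A : ℕ}

/-- The observations of the learner before the step `t`: the visited states and chosen actions
together with the rewards collected there. -/
def observe (M : NonstationaryMDP S A) {t : ℕ} (h : Fin t → Fin S × Fin A) :
    Fin t → Fin S × Fin A × ℝ :=
  fun i => ((h i).1, (h i).2, (M i).reward (h i).1 (h i).2)

/-- The joint law of the state-action pairs of the steps before `t` and of the state at the step
`t`, when `alg` interacts with `M` from the initial state `s₁`. -/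
def law (M : NonstationaryMDP S A) (alg : LearningAlgorithm S A) (s₁ : Fin S) :
    (t : ℕ) → PMF ((Fin t → Fin S × Fin A) × Fin S)
  | 0 => PMF.pure (Fin.elim0, s₁)
  | t + 1 => (law M alg s₁ t).bind fun x =>
      (alg t (M.observe x.1) x.2).bind fun a =>
        ((M t).trans x.2 a).map fun s' => (Fin.snoc x.1 (x.2, a), s')

/-- The expected reward collected at the step `t`. -/
def expectedReward (M : NonstationaryMDP S A) (alg : LearningAlgorithm S A) (s₁ : Fin S)
    (t : ℕ) : ℝ :=
  ∑ x : (Fin t → Fin S × Fin A) × Fin S, (M.law alg s₁ t x).toReal *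
    ∑ a : Fin A, (alg t (M.observe x.1) x.2 a).toReal * (M t).reward x.2 a

/-- The dynamic regret over `T` steps: the optimal average rewards of the MDPs in force, minus
the expected rewards collected, summed over the steps. -/
def dynamicRegret (M : NonstationaryMDP S A) (alg : LearningAlgorithm S A) (s₁ : Fin S)
    (T : ℕ) : ℝ :=
  ∑ t ∈ Finset.range T, ((M t).optimalGain s₁ - M.expectedReward alg s₁ t)

/-- The total variation of the transition kernels over `T` steps. -/
def transVariation (M : NonstationaryMDP S A) (T : ℕ) : ℝ :=
  ∑ t ∈ Finset.range (T - 1), ⨆ x : Fin S × Fin A,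
    ∑ s', |((M (t + 1)).trans x.1 x.2 s').toReal - ((M t).trans x.1 x.2 s').toReal|

/-- The total variation of the rewards over `T` steps. -/
def rewardVariation (M : NonstationaryMDP S A) (T : ℕ) : ℝ :=
  ∑ t ∈ Finset.range (T - 1), ⨆ x : Fin S × Fin A,
    |(M (t + 1)).reward x.1 x.2 - (M t).reward x.1 x.2|

end NonstationaryMDP

end

/-! The horizon is cut into windows of length `L`, and each window hides a fresh bandit problem. In
the hard instance (`HubTree`) a rewarding hub is left at rate about `1/D` towards the root of an
`A`-ary tree. At a leaf the learner waits without reward for a jump to the hub or back to the root,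
each at rate `δ = 2/D`; one hidden leaf-action pair raises the rate to the hub by `ε`. The number of
candidate pairs is of order `S * A`, and the tree is shallow enough for the diameter to be exactly
`D` (`diameter_mdp`).

Inner nodes pay the optimal average reward itself, so moving in the tree costs nothing. The Poisson
equation (`value_add_bias`) then turns regret, up to a nonnegative telescoping term, into `ε *
hubBias`, of order `ε * D`, times the expected number of steps spent in leaves off the special pair
(`sum_gap_le_sum_regret`).

A potential argument forces a constant fraction of a long window into leaves
(`le_sum_leafIndicator`). Without a special pair in the window, averaging gives a pair that is tried
at most `L / card` times in expectation, where `card` is the number of pairs, and each trial carries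
relative entropy at most `ε² * D` (`relativeEntropy_trans_le`). If `ε² * D * L` is at most a small
multiple of `S * A`, making this pair special changes the behaviour of the learner too little, and
the window costs order `ε * D * L` (`exists_special_pair`). Pairs are fixed window by window, since
the past does not depend on future kernels (`exists_special_pairs`).

The total is of order `ε * D * T`, at a variation of at most `2 * ε` per window boundary. With `ε`
of order `√(S * A / (D * L))`, the regret is of order `T * √(D * S * A / L)`, and
`exists_windowLength` picks `L` so that this matches the target within the budget. When this would
require a window longer than `T`, a single window without any change suffices. The two lower bounds
on `T` ensure `L ≥ D * S * A`, hence `ε * D ≤ 1`. -/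

noncomputable section

/-! ### Comparison principles for hitting times. -/

namespace TabularMDP

variable {S A : ℕ}

/-- A supersolution of the hitting time equations bounds the hitting time from above. -/
theorem hittingTime_le (M : TabularMDP S A) (π : Fin S → Fin A) (y : Fin S) {V : Fin S → ℝ≥0∞}
    (hV : ∀ x, x ≠ y → 1 + ∑ u, M.trans x (π x) u * V u ≤ V x) (x : Fin S) :
    M.hittingTime π x y ≤ V x := by
  have key : ∀ N x, ∑ n ∈ Finset.range N, M.survival π y n x ≤ V x := by
    intro N
    induction N with
    | zero => intro x; simp
    | succ N ih =>
      intro x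
      by_cases hx : x = y
      · have : ∀ n, M.survival π y n x = 0 := fun n => by cases n <;> simp [survival, hx]
        simp [this]
      · rw [Finset.sum_range_succ']
        have h1 : ∑ n ∈ Finset.range N, M.survival π y (n + 1) x
            = ∑ u, M.trans x (π x) u * ∑ n ∈ Finset.range N, M.survival π y n u := by
          simp only [survival, if_neg hx]
          rw [Finset.sum_comm]
          simp only [Finset.mul_sum]
        rw [h1]
        refine le_trans ?_ (hV x hx)
        rw [add_comm]
        simp only [survival, if_neg hx]
        gcongr with u
        exact ih u
  rw [hittingTime, ENNReal.tsum_eq_iSup_nat]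
  exact iSup_le fun N => key N x

/-- A bounded subsolution of the hitting time equations bounds the hitting time from below. -/
theorem le_hittingTime (M : TabularMDP S A) (π : Fin S → Fin A) (y : Fin S) {V : Fin S → ℝ≥0∞}
    {C : ℝ≥0∞} (hC : C ≠ ∞) (hVC : ∀ x, V x ≤ C) (hy : V y = 0)
    (hV : ∀ x, x ≠ y → V x ≤ 1 + ∑ u, M.trans x (π x) u * V u) (x : Fin S) :
    V x ≤ M.hittingTime π x y := by
  -- The remainder `C * survival` is what is left after unrolling the inequality `N` times;
  -- boundedness of `V` is needed so that it can vanish in the limit.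
  have key : ∀ N x, V x ≤ ∑ n ∈ Finset.range N, M.survival π y n x + C * M.survival π y N x := by
    intro N
    induction N with
    | zero =>
      intro x
      by_cases hx : x = y
      · simp [hx, hy]
      · simpa [survival, hx] using hVC x
    | succ N ih =>
      intro x
      by_cases hx : x = y
      · simp [hx, hy]
      · rw [Finset.sum_range_succ']
        have h1 : ∑ n ∈ Finset.range N, M.survival π y (n + 1) x
            = ∑ u, M.trans x (π x) u * ∑ n ∈ Finset.range N, M.survival π y n u := by
          simp only [survival, if_neg hx]
          rw [Finset.sum_comm]
          simp only [Finset.mul_sum]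
        have h2 : C * M.survival π y (N + 1) x
            = ∑ u, M.trans x (π x) u * (C * M.survival π y N u) := by
          simp only [survival, if_neg hx, Finset.mul_sum]
          exact Finset.sum_congr rfl fun u _ => by ring
        have h0 : M.survival π y 0 x = 1 := by simp [survival, hx]
        rw [h1, h2, h0]
        calc V x ≤ 1 + ∑ u, M.trans x (π x) u * V u := hV x hx
          _ ≤ 1 + ∑ u, M.trans x (π x) u *
              (∑ n ∈ Finset.range N, M.survival π y n u + C * M.survival π y N u) := by
            gcongr with u
            exact ih u
          _ = _ := by
            simp only [mul_add, Finset.sum_add_distrib]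
            ring
  -- A finite hitting time is a convergent series of survival probabilities, so these tend to zero
  -- and the remainder disappears.
  by_cases hfin : M.hittingTime π x y = ∞
  · simp [hfin]
  · have hs := ENNReal.tendsto_atTop_zero_of_tsum_ne_top hfin
    have hs' : Filter.Tendsto (fun N => C * M.survival π y N x) Filter.atTop (nhds 0) := by
      simpa using ENNReal.Tendsto.const_mul hs (Or.inr hC)
    have hlim := (ENNReal.tendsto_nat_tsum fun n => M.survival π y n x).add hs'
    rw [add_zero] at hlim
    exact ge_of_tendsto' hlim fun N => key N x

theorem sum_trans_mul_ofReal (M : TabularMDP S A) (x : Fin S) (a : Fin A) {V : Fin S → ℝ}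
    (hV : ∀ u, 0 ≤ V u) :
    ∑ u, M.trans x a u * ENNReal.ofReal (V u)
      = ENNReal.ofReal (∑ u, (M.trans x a u).toReal * V u) := by
  rw [ENNReal.ofReal_sum_of_nonneg fun u _ => mul_nonneg ENNReal.toReal_nonneg (hV u)]
  refine Finset.sum_congr rfl fun u _ => ?_
  rw [ENNReal.ofReal_mul ENNReal.toReal_nonneg, ENNReal.ofReal_toReal (PMF.apply_ne_top _ _)]

theorem hittingTime_le_ofReal (M : TabularMDP S A) (π : Fin S → Fin A) (y : Fin S)
    {V : Fin S → ℝ} (hV0 : ∀ x, 0 ≤ V x)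
    (hV : ∀ x, x ≠ y → 1 + ∑ u, (M.trans x (π x) u).toReal * V u ≤ V x) (x : Fin S) :
    M.hittingTime π x y ≤ ENNReal.ofReal (V x) := by
  refine M.hittingTime_le π y (V := fun x => ENNReal.ofReal (V x)) (fun x hx => ?_) x
  rw [sum_trans_mul_ofReal M _ _ hV0, ← ENNReal.ofReal_one, ← ENNReal.ofReal_add zero_le_one]
  · exact ENNReal.ofReal_le_ofReal (hV x hx)
  · exact Finset.sum_nonneg fun u _ => mul_nonneg ENNReal.toReal_nonneg (hV0 u)

theorem ofReal_le_hittingTime (M : TabularMDP S A) (π : Fin S → Fin A) (y : Fin S)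
    {V : Fin S → ℝ} (hV0 : ∀ x, 0 ≤ V x) {C : ℝ} (hC : ∀ x, V x ≤ C) (hy : V y = 0)
    (hV : ∀ x, x ≠ y → V x ≤ 1 + ∑ u, (M.trans x (π x) u).toReal * V u) (x : Fin S) :
    ENNReal.ofReal (V x) ≤ M.hittingTime π x y := by
  refine M.le_hittingTime π y (V := fun x => ENNReal.ofReal (V x)) (C := ENNReal.ofReal C)
    ENNReal.ofReal_ne_top (fun x => ENNReal.ofReal_le_ofReal (hC x)) (by simp [hy])
    (fun x hx => ?_) x
  rw [sum_trans_mul_ofReal M _ _ hV0, ← ENNReal.ofReal_one, ← ENNReal.ofReal_add zero_le_one]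
  · exact ENNReal.ofReal_le_ofReal (hV x hx)
  · exact Finset.sum_nonneg fun u _ => mul_nonneg ENNReal.toReal_nonneg (hV0 u)

end TabularMDP

theorem PMF.sum_toReal {α : Type*} [Fintype α] (p : PMF α) : ∑ u, (p u).toReal = 1 := by
  rw [← ENNReal.toReal_sum fun u _ => p.apply_ne_top u, ← tsum_fintype (L := .unconditional _),
    p.tsum_coe, ENNReal.toReal_one]

/-! ### Lower bounds on the long-run average reward. -/

namespace TabularMDP

variable {S A : ℕ}

theorem stateLaw_succ_toReal (M : TabularMDP S A) (π : Fin S → Fin A) (s : Fin S) (k : ℕ)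
    (v : Fin S) :
    (M.stateLaw π s (k + 1) v).toReal
      = ∑ u, (M.stateLaw π s k u).toReal * (M.trans u (π u) v).toReal := by
  rw [stateLaw, PMF.bind_apply, tsum_fintype, ENNReal.toReal_sum]
  · simp only [ENNReal.toReal_mul]
  · exact fun u _ => ENNReal.mul_ne_top (PMF.apply_ne_top _ _) (PMF.apply_ne_top _ _)

theorem average_le_one (M : TabularMDP S A) (π : Fin S → Fin A) (s : Fin S) (n : ℕ) :
    (∑ k ∈ Finset.range n, ∑ u, (M.stateLaw π s k u).toReal * M.reward u (π u)) / (n : ℝ) ≤ 1 := by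
  have h : ∀ k, ∑ u, (M.stateLaw π s k u).toReal * M.reward u (π u) ≤ 1 := fun k => by
    rw [← (M.stateLaw π s k).sum_toReal]
    exact Finset.sum_le_sum fun u _ =>
      mul_le_of_le_one_right ENNReal.toReal_nonneg (M.reward_mem u (π u)).2
  refine div_le_one_of_le₀ ?_ (Nat.cast_nonneg n)
  calc _ ≤ ∑ k ∈ Finset.range n, (1 : ℝ) := Finset.sum_le_sum fun k _ => h k
    _ = n := by simp

/-- A subsolution of the Poisson equation of a policy bounds its gain from below. -/
theorem le_gain (M : TabularMDP S A) (π : Fin S → Fin A) {ρ : ℝ} {h : Fin S → ℝ}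
    (H : ∀ x, ρ + h x ≤ M.reward x (π x) + ∑ u, (M.trans x (π x) u).toReal * h u) (s : Fin S) :
    ρ ≤ M.gain π s := by
  obtain ⟨C, hC⟩ : ∃ C, ∀ x, |h x| ≤ C :=
    ⟨∑ x, |h x|, fun x => Finset.single_le_sum (f := fun x => |h x|) (fun _ _ => abs_nonneg _)
      (Finset.mem_univ x)⟩
  set e : ℕ → ℝ := fun k => ∑ u, (M.stateLaw π s k u).toReal * h u with he
  have heC : ∀ k, |e k| ≤ C := fun k => by
    calc |e k| ≤ ∑ u, |(M.stateLaw π s k u).toReal * h u| := Finset.abs_sum_le_sum_abs _ _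
      _ ≤ ∑ u, (M.stateLaw π s k u).toReal * C := Finset.sum_le_sum fun u _ => by
          rw [abs_mul, abs_of_nonneg ENNReal.toReal_nonneg]
          exact mul_le_mul_of_nonneg_left (hC u) ENNReal.toReal_nonneg
      _ = C := by rw [← Finset.sum_mul, PMF.sum_toReal, one_mul]
  have hstep : ∀ k, ρ + e k
      ≤ (∑ u, (M.stateLaw π s k u).toReal * M.reward u (π u)) + e (k + 1) := fun k => by
    have h1 : e (k + 1) = ∑ u, (M.stateLaw π s k u).toReal *
        ∑ v, (M.trans u (π u) v).toReal * h v := by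
      simp only [he, stateLaw_succ_toReal, Finset.sum_mul, Finset.mul_sum]
      rw [Finset.sum_comm]
      exact Finset.sum_congr rfl fun u _ => Finset.sum_congr rfl fun v _ => by ring
    have h2 : ρ + e k = ∑ u, (M.stateLaw π s k u).toReal * (ρ + h u) := by
      simp only [mul_add, Finset.sum_add_distrib, ← Finset.sum_mul, PMF.sum_toReal, one_mul, he]
    rw [h1, h2, ← Finset.sum_add_distrib]
    refine Finset.sum_le_sum fun u _ => ?_
    rw [← mul_add]
    exact mul_le_mul_of_nonneg_left (H u) ENNReal.toReal_nonneg
  have hsum : ∀ n : ℕ, (n : ℝ) * ρ + e 0 - e n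
      ≤ ∑ k ∈ Finset.range n, ∑ u, (M.stateLaw π s k u).toReal * M.reward u (π u) := by
    intro n
    induction n with
    | zero => simp
    | succ n ih =>
      rw [Finset.sum_range_succ]
      push_cast
      linarith [hstep n]
  -- The telescoped bias costs at most `2 * C` in total, which is negligible after division by `n`.
  have hlim : Filter.Tendsto (fun n : ℕ => ρ - 2 * C / (n : ℝ)) Filter.atTop (nhds ρ) := by
    simpa using tendsto_const_nhds.sub (tendsto_const_div_atTop_nhds_zero_nat (2 * C))
  rw [← hlim.liminf_eq, gain]
  refine Filter.liminf_le_liminf ?_ hlim.isBoundedUnder_ge ?_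
  · filter_upwards [Filter.eventually_gt_atTop 0] with n hn
    have hn' : (0 : ℝ) < n := Nat.cast_pos.mpr hn
    rw [le_div_iff₀ hn', sub_mul, div_mul_cancel₀ _ hn'.ne']
    linarith [hsum n, abs_le.1 (heC 0), abs_le.1 (heC n), mul_comm ρ (n : ℝ)]
  · exact Filter.IsBoundedUnder.isCoboundedUnder_ge
      (Filter.isBoundedUnder_of ⟨1, fun n => M.average_le_one π s n⟩)

theorem le_optimalGain (M : TabularMDP S A) (π : Fin S → Fin A) {ρ : ℝ} {h : Fin S → ℝ}
    (H : ∀ x, ρ + h x ≤ M.reward x (π x) + ∑ u, (M.trans x (π x) u).toReal * h u) (s : Fin S) :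
    ρ ≤ M.optimalGain s :=
  (M.le_gain π H s).trans (le_ciSup (f := fun π => M.gain π s) (Set.finite_range _).bddAbove π)

end TabularMDP

/-! ### Relative entropy on finite types -/

section Entropy

variable {α β : Type*} [Fintype α] [Fintype β]

/-- The total variation distance is controlled by the relative entropy (through the Hellinger
distance). -/
theorem sum_abs_sub_sq_le (p q : α → ℝ) (hp : ∀ x, 0 ≤ p x) (hq : ∀ x, 0 ≤ q x)
    (hp1 : ∑ x, p x = 1) (hq1 : ∑ x, q x = 1) (hpq : ∀ x, q x = 0 → p x = 0) :
    (∑ x, |p x - q x|) ^ 2 ≤ 4 * ∑ x, p x * Real.log (p x / q x) := by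
  have h1 : ∑ x, (√(p x) - √(q x)) ^ 2 ≤ ∑ x, p x * Real.log (p x / q x) := by
    -- This is `log t ≤ t - 1` at `t = √(q/p)`; the extra term `q - p` sums to zero.
    have hpt : ∀ x, (√(p x) - √(q x)) ^ 2 ≤ p x * Real.log (p x / q x) + (q x - p x) := fun x => by
      rcases (hp x).eq_or_lt with h0 | h0
      · simp [← h0, Real.sq_sqrt (hq x)]
      · have hq0 : 0 < q x := lt_of_le_of_ne (hq x) fun h => h0.ne' (hpq x h.symm)
        have hsp := Real.sqrt_pos.2 h0
        have hsq := Real.sqrt_pos.2 hq0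
        have h2 := Real.log_le_sub_one_of_pos (div_pos hsq hsp)
        have h3 : Real.log (p x / q x) = -2 * Real.log (√(q x) / √(p x)) := by
          rw [Real.log_div h0.ne' hq0.ne', Real.log_div hsq.ne' hsp.ne', Real.log_sqrt hq0.le,
            Real.log_sqrt h0.le]
          ring
        have h4 : p x * (√(q x) / √(p x)) = √(p x) * √(q x) := by
          nth_rewrite 1 [← Real.mul_self_sqrt h0.le]
          field_simp
        rw [h3]
        nlinarith [mul_le_mul_of_nonneg_left h2 h0.le, Real.sq_sqrt h0.le, Real.sq_sqrt hq0.le]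
    calc _ ≤ ∑ x, (p x * Real.log (p x / q x) + (q x - p x)) := Finset.sum_le_sum fun x _ => hpt x
      _ = _ := by rw [Finset.sum_add_distrib, Finset.sum_sub_distrib, hp1, hq1]; ring
  have h2 : ∑ x, (√(p x) + √(q x)) ^ 2 ≤ 4 := by
    calc _ ≤ ∑ x, (2 * p x + 2 * q x) := Finset.sum_le_sum fun x _ => by
          nlinarith [Real.sq_sqrt (hp x), Real.sq_sqrt (hq x), sq_nonneg (√(p x) - √(q x))]
      _ = 4 := by
          rw [Finset.sum_add_distrib, ← Finset.mul_sum, ← Finset.mul_sum, hp1, hq1]; norm_num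
  -- Factoring `p - q` as a difference of squares of roots prepares Cauchy–Schwarz against the
  -- Hellinger distance.
  have h3 : ∑ x, |p x - q x| = ∑ x, |√(p x) - √(q x)| * (√(p x) + √(q x)) :=
    Finset.sum_congr rfl fun x _ => by
      rw [← abs_of_nonneg (add_nonneg (Real.sqrt_nonneg (p x)) (Real.sqrt_nonneg (q x))),
        ← abs_mul]
      congr 1
      nlinarith [Real.sq_sqrt (hp x), Real.sq_sqrt (hq x)]
  have h4 : 0 ≤ ∑ x, (√(p x) - √(q x)) ^ 2 := Finset.sum_nonneg fun _ _ => sq_nonneg _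
  rw [h3]
  calc _ ≤ (∑ x, |√(p x) - √(q x)| ^ 2) * ∑ x, (√(p x) + √(q x)) ^ 2 :=
        Finset.sum_mul_sq_le_sq_mul_sq _ _ _
    _ ≤ (∑ x, (√(p x) - √(q x)) ^ 2) * 4 := by
        simp only [sq_abs]
        exact mul_le_mul_of_nonneg_left h2 h4
    _ ≤ _ := by linarith

/-- The relative entropy is at most the chi-squared divergence. -/
theorem sum_mul_log_le_sum_sq_div (p q : α → ℝ) (hp : ∀ x, 0 ≤ p x) (hq : ∀ x, 0 ≤ q x)
    (hp1 : ∑ x, p x = 1) (hq1 : ∑ x, q x = 1) (hpq : ∀ x, q x = 0 → p x = 0) :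
    ∑ x, p x * Real.log (p x / q x) ≤ ∑ x, (p x - q x) ^ 2 / q x := by
  have hpt : ∀ x, p x * Real.log (p x / q x) ≤ (p x - q x) ^ 2 / q x + (p x - q x) := fun x => by
    rcases (hp x).eq_or_lt with h0 | h0
    · rcases (hq x).eq_or_lt with h1 | h1
      · simp [← h0, ← h1]
      · rw [← h0]; field_simp; simp
    · have hq0 : 0 < q x := lt_of_le_of_ne (hq x) fun h => h0.ne' (hpq x h.symm)
      have h2 := mul_le_mul_of_nonneg_left (Real.log_le_sub_one_of_pos (div_pos h0 hq0)) h0.le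
      refine h2.trans (le_of_eq ?_)
      field_simp
      ring
  calc _ ≤ ∑ x, ((p x - q x) ^ 2 / q x + (p x - q x)) := Finset.sum_le_sum fun x _ => hpt x
    _ = _ := by rw [Finset.sum_add_distrib, Finset.sum_sub_distrib, hp1, hq1]; ring

/-- The chain rule for the relative entropy. -/
theorem sum_mul_log_chain (p q : α → ℝ) (k l : α → β → ℝ)
    (hk1 : ∀ x, ∑ b, k x b = 1) (hpq : ∀ x, q x = 0 → p x = 0)
    (hkl : ∀ x b, l x b = 0 → k x b = 0) :
    ∑ y : α × β, (p y.1 * k y.1 y.2) * Real.log (p y.1 * k y.1 y.2 / (q y.1 * l y.1 y.2))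
      = ∑ x, p x * Real.log (p x / q x) + ∑ x, p x * ∑ b, k x b * Real.log (k x b / l x b) := by
  rw [Fintype.sum_prod_type, ← Finset.sum_add_distrib]
  refine Finset.sum_congr rfl fun x _ => ?_
  have hpt : ∀ b, (p x * k x b) * Real.log (p x * k x b / (q x * l x b))
      = p x * Real.log (p x / q x) * k x b + p x * (k x b * Real.log (k x b / l x b)) := fun b => by
    by_cases hp : p x = 0
    · simp [hp]
    by_cases hk : k x b = 0
    · simp [hk]
    have hq : q x ≠ 0 := fun h => hp (hpq x h)
    have hl : l x b ≠ 0 := fun h => hk (hkl x b h)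
    rw [mul_div_mul_comm, Real.log_mul (div_ne_zero hp hq) (div_ne_zero hk hl)]
    ring
  rw [Finset.sum_congr rfl fun b _ => hpt b, Finset.sum_add_distrib, ← Finset.mul_sum, hk1,
    mul_one, ← Finset.mul_sum]

end Entropy

/-! ### The law of the interaction -/

namespace NonstationaryMDP

variable {S A : ℕ}

/-- The histories of length `t + 1` are those of length `t` followed by an action and a state. -/
def historyEquiv (S A t : ℕ) :
    ((Fin t → Fin S × Fin A) × Fin S) × (Fin A × Fin S) ≃
      (Fin (t + 1) → Fin S × Fin A) × Fin S where
  toFun y := (Fin.snoc y.1.1 (y.1.2, y.2.1), y.2.2)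
  invFun x := ((Fin.init x.1, (x.1 (Fin.last t)).1), ((x.1 (Fin.last t)).2, x.2))
  left_inv y := by simp
  right_inv x := by simp

theorem law_succ_apply (M : NonstationaryMDP S A) (alg : LearningAlgorithm S A) (s₁ : Fin S)
    (t : ℕ) (y : ((Fin t → Fin S × Fin A) × Fin S) × (Fin A × Fin S)) :
    M.law alg s₁ (t + 1) (historyEquiv S A t y)
      = M.law alg s₁ t y.1 *
        (alg t (M.observe y.1.1) y.1.2 y.2.1 * (M t).trans y.1.2 y.2.1 y.2.2) := by
  obtain ⟨x, a, s'⟩ := y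
  rw [law, PMF.bind_apply, tsum_fintype, Finset.sum_eq_single x]
  · congr 1
    rw [PMF.bind_apply, tsum_fintype, Finset.sum_eq_single a]
    · congr 1
      rw [PMF.map_apply, tsum_fintype, Finset.sum_eq_single s']
      · simp [historyEquiv]
      · intro u _ hu
        simp [historyEquiv, Ne.symm hu]
      · simp
    · intro b _ hb
      rw [PMF.map_apply, tsum_fintype, Finset.sum_eq_zero, mul_zero]
      intro u _
      rw [if_neg]
      intro h
      have := (historyEquiv S A t).injective (a₁ := (x, a, s')) (a₂ := (x, b, u)) h
      simp_all
    · simp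
  · intro x' _ hx'
    rw [PMF.bind_apply, tsum_fintype, Finset.sum_eq_zero, mul_zero]
    intro b _
    rw [PMF.map_apply, tsum_fintype, Finset.sum_eq_zero, mul_zero]
    intro u _
    rw [if_neg]
    intro h
    have := (historyEquiv S A t).injective (a₁ := (x, a, s')) (a₂ := (x', b, u)) h
    simp_all
  · simp

/-! ### Occupation measures and the Markov property. -/

/-- The expectation of `f (s_t, a_t)`. -/
def occupation (M : NonstationaryMDP S A) (alg : LearningAlgorithm S A) (s₁ : Fin S) (t : ℕ)
    (f : Fin S → Fin A → ℝ) : ℝ :=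
  ∑ x, (M.law alg s₁ t x).toReal * ∑ a, (alg t (M.observe x.1) x.2 a).toReal * f x.2 a

/-- The expectation of `h (s_t)`. -/
def stateMean (M : NonstationaryMDP S A) (alg : LearningAlgorithm S A) (s₁ : Fin S) (t : ℕ)
    (h : Fin S → ℝ) : ℝ :=
  ∑ x, (M.law alg s₁ t x).toReal * h x.2

variable (M : NonstationaryMDP S A) (alg : LearningAlgorithm S A) (s₁ : Fin S) (t : ℕ)

theorem expectedReward_eq_occupation :
    M.expectedReward alg s₁ t = M.occupation alg s₁ t (M t).reward := rfl

theorem occupation_add (f g : Fin S → Fin A → ℝ) :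
    M.occupation alg s₁ t (fun s a => f s a + g s a)
      = M.occupation alg s₁ t f + M.occupation alg s₁ t g := by
  simp only [occupation, mul_add, Finset.sum_add_distrib]

theorem occupation_smul (c : ℝ) (f : Fin S → Fin A → ℝ) :
    M.occupation alg s₁ t (fun s a => c * f s a) = c * M.occupation alg s₁ t f := by
  simp only [occupation, Finset.mul_sum]
  exact Finset.sum_congr rfl fun _ _ => Finset.sum_congr rfl fun _ _ => by ring

theorem occupation_sum {ι : Type*} (I : Finset ι) (f : ι → Fin S → Fin A → ℝ) :
    M.occupation alg s₁ t (fun s a => ∑ i ∈ I, f i s a)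
      = ∑ i ∈ I, M.occupation alg s₁ t (f i) := by
  classical
  induction I using Finset.induction_on with
  | empty => simp [occupation]
  | insert i I hi ih => simp only [Finset.sum_insert hi, occupation_add, ih]

theorem occupation_mono {f g : Fin S → Fin A → ℝ} (h : ∀ s a, f s a ≤ g s a) :
    M.occupation alg s₁ t f ≤ M.occupation alg s₁ t g :=
  Finset.sum_le_sum fun _ _ => mul_le_mul_of_nonneg_left
    (Finset.sum_le_sum fun _ _ => mul_le_mul_of_nonneg_left (h _ _) ENNReal.toReal_nonneg)
    ENNReal.toReal_nonneg

theorem occupation_state (h : Fin S → ℝ) :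
    M.occupation alg s₁ t (fun s _ => h s) = M.stateMean alg s₁ t h := by
  simp only [occupation, stateMean, ← Finset.sum_mul, PMF.sum_toReal, one_mul]

theorem stateMean_const (c : ℝ) : M.stateMean alg s₁ t (fun _ => c) = c := by
  simp only [stateMean, ← Finset.sum_mul, PMF.sum_toReal, one_mul]

theorem stateMean_mono {f g : Fin S → ℝ} (h : ∀ s, f s ≤ g s) :
    M.stateMean alg s₁ t f ≤ M.stateMean alg s₁ t g :=
  Finset.sum_le_sum fun _ _ => mul_le_mul_of_nonneg_left (h _) ENNReal.toReal_nonneg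

theorem stateMean_zero (h : Fin S → ℝ) : M.stateMean alg s₁ 0 h = h s₁ := by
  rw [stateMean, Finset.sum_eq_single (Fin.elim0, s₁)]
  · simp [law]
  · intro x _ hx
    simp [law, PMF.pure_apply, hx]
  · simp

/-- The Markov property. -/
theorem stateMean_succ (h : Fin S → ℝ) :
    M.stateMean alg s₁ (t + 1) h
      = M.occupation alg s₁ t fun s a => ∑ u, ((M t).trans s a u).toReal * h u := by
  rw [stateMean, ← (historyEquiv S A t).sum_comp, occupation, Fintype.sum_prod_type]
  refine Finset.sum_congr rfl fun x _ => ?_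
  rw [Fintype.sum_prod_type, Finset.mul_sum]
  refine Finset.sum_congr rfl fun a _ => ?_
  rw [Finset.mul_sum, Finset.mul_sum]
  refine Finset.sum_congr rfl fun u _ => ?_
  rw [law_succ_apply, ENNReal.toReal_mul, ENNReal.toReal_mul]
  simp only [historyEquiv, Equiv.coe_fn_mk]
  ring

/-- Causality: the kernel in force at a step acts only on the next state. This lets the adversary
choose later windows without disturbing earlier ones. -/
theorem law_congr {M M' : NonstationaryMDP S A} (h : ∀ i < t, M i = M' i) :
    M.law alg s₁ t = M'.law alg s₁ t := by
  induction t with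
  | zero => rfl
  | succ t ih =>
    have hobs : ∀ x : Fin t → Fin S × Fin A, M.observe x = M'.observe x := fun x => by
      funext i
      simp only [observe, h i (i.2.trans (Nat.lt_succ_self t))]
    rw [law, law, ih fun i hi => h i (hi.trans (Nat.lt_succ_self t)), h t (Nat.lt_succ_self t)]
    simp only [hobs]

theorem occupation_congr {M M' : NonstationaryMDP S A} (h : ∀ i < t, M i = M' i) :
    M.occupation alg s₁ t = M'.occupation alg s₁ t := by
  funext f
  have hobs : ∀ x : Fin t → Fin S × Fin A, M.observe x = M'.observe x := fun x => by
    funext i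
    simp only [observe, h i i.2]
  simp only [occupation, law_congr alg s₁ t h, hobs]

/-! ### Change of measure -/

section ChangeOfMeasure

variable {M M' : NonstationaryMDP S A}

theorem observe_congr (hr : ∀ t, (M t).reward = (M' t).reward) {t : ℕ}
    (x : Fin t → Fin S × Fin A) : M.observe x = M'.observe x := by
  funext i
  simp only [observe, hr]

theorem law_eq_zero_of_law_eq_zero (hr : ∀ t, (M t).reward = (M' t).reward)
    (h0 : ∀ t s a u, (M' t).trans s a u = 0 → (M t).trans s a u = 0) (t : ℕ)
    (x : (Fin t → Fin S × Fin A) × Fin S) (hx : M'.law alg s₁ t x = 0) :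
    M.law alg s₁ t x = 0 := by
  induction t with
  | zero => exact hx
  | succ t ih =>
    obtain ⟨y, rfl⟩ := (historyEquiv S A t).surjective x
    rw [law_succ_apply] at hx ⊢
    rw [observe_congr hr]
    rcases mul_eq_zero.1 hx with h | h
    · simp [ih _ h]
    · rcases mul_eq_zero.1 h with h | h
      · simp [h]
      · simp [h0 _ _ _ _ h]

/-- The relative entropy between the laws of the interaction with two processes that differ only
in their transitions. -/
theorem relativeEntropy_law_le (hr : ∀ t, (M t).reward = (M' t).reward)
    (h0 : ∀ t s a u, (M' t).trans s a u = 0 → (M t).trans s a u = 0)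
    {κ : ℕ → Fin S → Fin A → ℝ}
    (hκ : ∀ t s a, ∑ u, ((M t).trans s a u).toReal *
      Real.log (((M t).trans s a u).toReal / ((M' t).trans s a u).toReal) ≤ κ t s a) (t : ℕ) :
    ∑ x, (M.law alg s₁ t x).toReal *
        Real.log ((M.law alg s₁ t x).toReal / (M'.law alg s₁ t x).toReal)
      ≤ ∑ i ∈ Finset.range t, M.occupation alg s₁ i (κ i) := by
  have hz : ∀ {a : ℝ≥0∞}, a ≠ ∞ → (a.toReal = 0 ↔ a = 0) := fun h => by
    simp [ENNReal.toReal_eq_zero_iff, h]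
  induction t with
  | zero =>
    have : ∀ x, M.law alg s₁ 0 x = M'.law alg s₁ 0 x := fun _ => rfl
    simp only [this, Finset.range_zero, Finset.sum_empty]
    refine le_of_eq (Finset.sum_eq_zero fun x _ => ?_)
    by_cases h : (M'.law alg s₁ 0 x).toReal = 0
    · simp [h]
    · simp [div_self h]
  | succ t ih =>
    rw [Finset.sum_range_succ, ← (historyEquiv S A t).sum_comp]
    simp only [law_succ_apply, ← observe_congr hr, ENNReal.toReal_mul]
    -- Both processes show the learner the same observations, so the action probabilities cancel in
    -- the likelihood ratio and only the transition kernels contribute.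
    rw [sum_mul_log_chain (fun x => (M.law alg s₁ t x).toReal)
      (fun x => (M'.law alg s₁ t x).toReal)
      (fun x (b : Fin A × Fin S) => (alg t (M.observe x.1) x.2 b.1).toReal *
        ((M t).trans x.2 b.1 b.2).toReal)
      (fun x (b : Fin A × Fin S) => (alg t (M.observe x.1) x.2 b.1).toReal *
        ((M' t).trans x.2 b.1 b.2).toReal)]
    · refine add_le_add ih (Finset.sum_le_sum fun x _ =>
        mul_le_mul_of_nonneg_left ?_ ENNReal.toReal_nonneg)
      rw [Fintype.sum_prod_type]
      refine Finset.sum_le_sum fun a _ => ?_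
      refine le_trans (le_of_eq ?_) (mul_le_mul_of_nonneg_left (hκ t x.2 a) ENNReal.toReal_nonneg)
      rw [Finset.mul_sum]
      refine Finset.sum_congr rfl fun u _ => ?_
      by_cases h : (alg t (M.observe x.1) x.2 a).toReal = 0
      · simp [h]
      · rw [mul_div_mul_left _ _ h, mul_assoc]
    · intro x
      simp only [Fintype.sum_prod_type, ← Finset.mul_sum, PMF.sum_toReal, mul_one]
    · intro x hx
      rw [hz (PMF.apply_ne_top _ _)] at hx ⊢
      exact law_eq_zero_of_law_eq_zero alg s₁ hr h0 t x hx
    · intro x b hb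
      rcases mul_eq_zero.1 hb with h | h
      · simp [h]
      · rw [hz (PMF.apply_ne_top _ _)] at h
        simp [h0 _ _ _ _ h]

/-- The probabilities of an event at the step `t` under two processes that differ only in their
transitions. -/
theorem occupation_sub_le (hr : ∀ t, (M t).reward = (M' t).reward)
    (h0 : ∀ t s a u, (M' t).trans s a u = 0 → (M t).trans s a u = 0)
    {κ : ℕ → Fin S → Fin A → ℝ}
    (hκ : ∀ t s a, ∑ u, ((M t).trans s a u).toReal *
      Real.log (((M t).trans s a u).toReal / ((M' t).trans s a u).toReal) ≤ κ t s a) (t : ℕ)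
    {f : Fin S → Fin A → ℝ} (hf0 : ∀ s a, 0 ≤ f s a) (hf1 : ∀ s a, f s a ≤ 1) :
    M.occupation alg s₁ t f - M'.occupation alg s₁ t f
      ≤ 2 * √(∑ i ∈ Finset.range t, M.occupation alg s₁ i (κ i)) := by
  have hz : ∀ {a : ℝ≥0∞}, a ≠ ∞ → (a.toReal = 0 ↔ a = 0) := fun h => by
    simp [ENNReal.toReal_eq_zero_iff, h]
  have h1 := sum_abs_sub_sq_le (fun x => (M.law alg s₁ t x).toReal)
    (fun x => (M'.law alg s₁ t x).toReal) (fun _ => ENNReal.toReal_nonneg)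
    (fun _ => ENNReal.toReal_nonneg) (PMF.sum_toReal _) (PMF.sum_toReal _) (fun x hx => by
      rw [hz (PMF.apply_ne_top _ _)] at hx ⊢
      exact law_eq_zero_of_law_eq_zero alg s₁ hr h0 t x hx)
  have h2 := h1.trans (mul_le_mul_of_nonneg_left
    (relativeEntropy_law_le alg s₁ hr h0 hκ t) (by norm_num : (0 : ℝ) ≤ 4))
  have h3 : ∑ x, |(M.law alg s₁ t x).toReal - (M'.law alg s₁ t x).toReal|
      ≤ 2 * √(∑ i ∈ Finset.range t, M.occupation alg s₁ i (κ i)) := by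
    have h4 := Real.le_sqrt_of_sq_le h2
    rwa [Real.sqrt_mul (by norm_num), show (4 : ℝ) = 2 ^ 2 by norm_num,
      Real.sqrt_sq (by norm_num)] at h4
  refine le_trans ?_ h3
  rw [occupation, occupation, ← Finset.sum_sub_distrib]
  refine Finset.sum_le_sum fun x _ => ?_
  rw [observe_congr hr, ← sub_mul]
  have h5 : 0 ≤ ∑ a, (alg t (M'.observe x.1) x.2 a).toReal * f x.2 a :=
    Finset.sum_nonneg fun a _ => mul_nonneg ENNReal.toReal_nonneg (hf0 _ _)
  have h6 : ∑ a, (alg t (M'.observe x.1) x.2 a).toReal * f x.2 a ≤ 1 := by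
    rw [← (alg t (M'.observe x.1) x.2).sum_toReal]
    exact Finset.sum_le_sum fun a _ =>
      mul_le_of_le_one_right ENNReal.toReal_nonneg (hf1 _ _)
  calc _ ≤ |(M.law alg s₁ t x).toReal - (M'.law alg s₁ t x).toReal| *
        ∑ a, (alg t (M'.observe x.1) x.2 a).toReal * f x.2 a :=
        mul_le_mul_of_nonneg_right (le_abs_self _) h5
    _ ≤ _ := mul_le_of_le_one_right (abs_nonneg _) h6

end ChangeOfMeasure

end NonstationaryMDP

/-! ### Heap-ordered trees -/

/-- The depth of the node `i` of the heap-ordered complete `A`-ary tree, in which the children of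
`i` are `A * i + 1, …, A * i + A`. -/
def heapDepth (A : ℕ) : ℕ → ℕ
  | 0 => 0
  | i + 1 => heapDepth A (i / A) + 1
  termination_by i => i
  decreasing_by exact Nat.lt_succ_of_le (Nat.div_le_self i A)

/-- `HeapAncestor A y i`: the node `i` is `y` or an ancestor of `y`. -/
inductive HeapAncestor (A y : ℕ) : ℕ → Prop
  | refl : HeapAncestor A y y
  | step {i b : ℕ} : b < A → HeapAncestor A y (A * i + 1 + b) → HeapAncestor A y i

section Heap

variable {A : ℕ}

theorem heapDepth_zero : heapDepth A 0 = 0 := by rw [heapDepth]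

theorem heapDepth_child {i b : ℕ} (hb : b < A) :
    heapDepth A (A * i + 1 + b) = heapDepth A i + 1 := by
  rw [show A * i + 1 + b = (A * i + b) + 1 by ring, heapDepth,
    Nat.mul_add_div (by omega), Nat.div_eq_of_lt hb, add_zero]

theorem heapDepth_mono : Monotone (heapDepth A) := by
  intro i j
  induction i using Nat.strong_induction_on generalizing j with
  | _ i ih =>
    intro hij
    rcases i with _ | i
    · simp [heapDepth_zero]
    · rcases j with _ | j
      · omega
      · rw [heapDepth, heapDepth]
        exact Nat.succ_le_succ (ih _ (Nat.lt_succ_of_le (Nat.div_le_self i A))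
          (Nat.div_le_div_right (by omega)))

/-- Passing to the parent divides the index by `A` and lowers the depth by one; this is the
logarithmic depth bound in multiplicative form. -/
theorem pow_heapDepth_le (i : ℕ) : A ^ heapDepth A (i + 1) ≤ A * (i + 1) := by
  induction i using Nat.strong_induction_on with
  | _ i ih =>
    rw [heapDepth]
    rcases h : i / A with _ | j
    · rw [heapDepth_zero, zero_add, pow_one]
      exact Nat.le_mul_of_pos_right A (Nat.succ_pos i)
    · have hji : j < i := by
        have := Nat.div_le_self i A
        omega
      have h2 : A * (j + 1) ≤ i := h ▸ Nat.mul_div_le i A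
      calc A ^ (heapDepth A (j + 1) + 1) = A * A ^ heapDepth A (j + 1) := by ring
        _ ≤ A * (A * (j + 1)) := Nat.mul_le_mul_left A (ih j hji)
        _ ≤ A * (i + 1) := Nat.mul_le_mul_left A (h2.trans (Nat.le_succ i))

theorem HeapAncestor.root {y : ℕ} (hA : 0 < A) : HeapAncestor A y 0 := by
  have key : ∀ i, HeapAncestor A y i → HeapAncestor A y 0 := by
    intro i
    induction i using Nat.strong_induction_on with
    | _ i ih =>
      intro h
      rcases i with _ | i
      · exact h
      · refine ih (i / A) (Nat.lt_succ_of_le (Nat.div_le_self i A))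
          (HeapAncestor.step (Nat.mod_lt i hA) ?_)
        rwa [show A * (i / A) + 1 + i % A = i + 1 by rw [add_right_comm, Nat.div_add_mod]]
  exact key y .refl

theorem HeapAncestor.le {y i : ℕ} (hA : 0 < A) (h : HeapAncestor A y i) : i ≤ y := by
  induction h with
  | refl => exact le_rfl
  | @step i b _ _ ih =>
    have : i ≤ A * i := Nat.le_mul_of_pos_left i hA
    omega

theorem HeapAncestor.exists_child {y i : ℕ} (h : HeapAncestor A y i) (hi : i ≠ y) :
    ∃ b < A, HeapAncestor A y (A * i + 1 + b) := by
  cases h with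
  | refl => exact absurd rfl hi
  | step hb h => exact ⟨_, hb, h⟩

end Heap

/-! ### The lower bound construction -/

/-- The data of the hard instances. The states are numbered by `pos`; the last one is the hub, and
the others are the nodes of a heap-ordered `A`-ary tree. The hub is rewarding and is left with a
small probability towards the root; in the inner nodes the learner descends to a child of its
choice; in the leaves it waits for a jump to the hub or to the root. One action in one leaf may
make the jump to the hub more likely, by `ε`. -/
structure HubTree (S A : ℕ) where
  pos : Fin S ≃ Fin S
  D : ℝ
  ε : ℝ
  two_le_S : 2 ≤ S
  two_le_A : 2 ≤ A
  le_D : 20 ≤ D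
  depth_le : 10 * (heapDepth A (S - 2) : ℝ) ≤ D
  ε_pos : 0 < ε
  ε_mul_le : ε * D ≤ 1

namespace HubTree

variable {S A : ℕ} (H : HubTree S A)

/-- The state with the number `j`. -/
def node (j : ℕ) : Fin S :=
  H.pos.symm ⟨min j (S - 1), by have := H.two_le_S; omega⟩

def IsHub (x : Fin S) : Prop := (H.pos x : ℕ) = S - 1

/-- The first child would have the number `A * pos + 1`, whereas the tree ends at `S - 2`. -/
def IsLeaf (x : Fin S) : Prop := (H.pos x : ℕ) ≠ S - 1 ∧ S - 1 ≤ A * H.pos x + 1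

open scoped Classical in
/-- The node to which the action `a` leads from an inner node. -/
def target (x : Fin S) (a : Fin A) : Fin S :=
  -- The last inner node may have fewer than `A` children; the minimum sends its surplus actions to
  -- node `S - 2`, which is still one of them. In the hub and the leaves the target receives the
  -- probability of staying put.
  if H.IsHub x ∨ H.IsLeaf x then x else H.node (min (A * H.pos x + 1 + a) (S - 2))

def depth (_H : HubTree S A) : ℝ := heapDepth A (S - 2)

/-- The mean waiting time in the hub plus the depth of the tree is then exactly `D`, the time needed
from the hub to the last node. -/
def exitProb : ℝ := 1 / (H.D - H.depth)

def δ : ℝ := 2 / H.D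

/-- The bias of the hub relative to the other states. -/
def hubBias : ℝ := 1 / (H.exitProb + H.δ + H.ε)

/-- The optimal average reward. -/
def value : ℝ := (H.δ + H.ε) * H.hubBias

def bonus (z : Option (Fin S × Fin A)) (x : Fin S) (a : Fin A) : ℝ :=
  if z = some (x, a) then H.ε else 0

open scoped Classical in
def hubProb (z : Option (Fin S × Fin A)) (x : Fin S) (a : Fin A) : ℝ :=
  if H.IsHub x then 1 - H.exitProb else if H.IsLeaf x then H.δ + H.bonus z x a else 0

open scoped Classical in
def rootProb (x : Fin S) : ℝ :=
  if H.IsHub x then H.exitProb else if H.IsLeaf x then H.δ else 0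

def weight (z : Option (Fin S × Fin A)) (x : Fin S) (a : Fin A) (u : Fin S) : ℝ :=
  H.hubProb z x a * (if u = H.node (S - 1) then 1 else 0)
    + H.rootProb x * (if u = H.node 0 then 1 else 0)
    + (1 - H.hubProb z x a - H.rootProb x) * (if u = H.target x a then 1 else 0)

/-! #### Numerical facts -/

theorem D_pos : 0 < H.D := by linarith [H.le_D]

theorem depth_nonneg : 0 ≤ H.depth := Nat.cast_nonneg _

theorem ten_mul_depth_le : 10 * H.depth ≤ H.D := H.depth_le

theorem exitProb_mul : H.exitProb * (H.D - H.depth) = 1 := by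
  rw [exitProb, one_div_mul_cancel]
  linarith [H.D_pos, H.ten_mul_depth_le]

theorem δ_mul : H.δ * H.D = 2 := div_mul_cancel₀ _ H.D_pos.ne'

theorem exitProb_pos : 0 < H.exitProb :=
  one_div_pos.2 (by linarith [H.D_pos, H.ten_mul_depth_le])

theorem δ_pos : 0 < H.δ := div_pos two_pos H.D_pos

theorem exitProb_le : H.exitProb ≤ 1 / 18 :=
  one_div_le_one_div_of_le (by norm_num) (by linarith [H.le_D, H.ten_mul_depth_le])

theorem exitProb_mul_D_le : H.exitProb * H.D ≤ 10 / 9 := by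
  nlinarith [H.exitProb_mul, H.exitProb_pos, H.ten_mul_depth_le]

theorem δ_le : H.δ ≤ 1 / 10 := by nlinarith [H.δ_mul, H.le_D, H.δ_pos]

theorem ε_le : H.ε ≤ 1 / 20 := by nlinarith [H.ε_mul_le, H.le_D, H.ε_pos]

theorem rates_pos : 0 < H.exitProb + H.δ + H.ε := by
  linarith [H.exitProb_pos, H.δ_pos, H.ε_pos]

theorem hubBias_pos : 0 < H.hubBias := one_div_pos.2 H.rates_pos

theorem rates_mul_hubBias : (H.exitProb + H.δ + H.ε) * H.hubBias = 1 :=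
  mul_one_div_cancel H.rates_pos.ne'

theorem value_eq : H.value = 1 - H.exitProb * H.hubBias := by
  linarith [H.rates_mul_hubBias, show H.value = (H.δ + H.ε) * H.hubBias from rfl]

theorem D_le_hubBias : H.D ≤ 5 * H.hubBias := by
  have h1 : (H.exitProb + H.δ + H.ε) * H.D ≤ 5 := by
    linarith [H.exitProb_mul_D_le, H.δ_mul, H.ε_mul_le]
  calc H.D = (H.exitProb + H.δ + H.ε) * H.D * H.hubBias := by
        rw [mul_right_comm, H.rates_mul_hubBias, one_mul]
    _ ≤ 5 * H.hubBias := mul_le_mul_of_nonneg_right h1 H.hubBias_pos.le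

theorem value_mem : H.value ∈ Set.Icc (0 : ℝ) 1 := by
  refine ⟨mul_nonneg (by linarith [H.δ_pos, H.ε_pos]) H.hubBias_pos.le, ?_⟩
  rw [value_eq]
  linarith [mul_pos H.exitProb_pos H.hubBias_pos]

theorem bonus_nonneg (z x a) : 0 ≤ H.bonus z x a := by
  unfold bonus; split_ifs <;> linarith [H.ε_pos]

theorem bonus_le (z x a) : H.bonus z x a ≤ H.ε := by
  unfold bonus; split_ifs <;> linarith [H.ε_pos]

theorem hubProb_nonneg (z x a) : 0 ≤ H.hubProb z x a := by
  unfold hubProb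
  split_ifs <;> linarith [H.exitProb_le, H.δ_pos, H.bonus_nonneg z x a]

theorem rootProb_nonneg (x) : 0 ≤ H.rootProb x := by
  unfold rootProb
  split_ifs <;> linarith [H.exitProb_pos, H.δ_pos]

theorem hubProb_add_rootProb_le (z x a) : 0 ≤ 1 - H.hubProb z x a - H.rootProb x := by
  unfold hubProb rootProb
  split_ifs <;> linarith [H.exitProb_pos, H.δ_le, H.bonus_le z x a, H.ε_le]

theorem weight_nonneg (z x a u) : 0 ≤ H.weight z x a u := by
  have h : ∀ p : Prop, [Decidable p] → (0 : ℝ) ≤ if p then 1 else 0 := fun p _ => by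
    split_ifs <;> norm_num
  exact add_nonneg (add_nonneg (mul_nonneg (H.hubProb_nonneg z x a) (h _))
    (mul_nonneg (H.rootProb_nonneg x) (h _))) (mul_nonneg (H.hubProb_add_rootProb_le z x a) (h _))

theorem sum_weight_mul (z x a) (f : Fin S → ℝ) :
    ∑ u, H.weight z x a u * f u = H.hubProb z x a * f (H.node (S - 1))
      + H.rootProb x * f (H.node 0)
      + (1 - H.hubProb z x a - H.rootProb x) * f (H.target x a) := by
  simp [weight, add_mul, Finset.sum_add_distrib]

theorem sum_weight (z x a) : ∑ u, H.weight z x a u = 1 := by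
  have := H.sum_weight_mul z x a fun _ => 1
  simp only [mul_one] at this
  rw [this]
  ring

open scoped Classical in
/-- The hard instance with the special pair `z`. -/
def mdp (z : Option (Fin S × Fin A)) : TabularMDP S A where
  -- The rewards are the same for every `z`: they neither vary between windows nor reveal the
  -- special pair.
  reward x _ := if H.IsHub x then 1 else if H.IsLeaf x then 0 else H.value
  reward_mem x a := by
    split_ifs
    · norm_num
    · norm_num
    · exact H.value_mem
  trans x a := PMF.ofFintype (fun u => ENNReal.ofReal (H.weight z x a u)) (by
    rw [← ENNReal.ofReal_sum_of_nonneg fun u _ => H.weight_nonneg z x a u, H.sum_weight,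
      ENNReal.ofReal_one])

theorem trans_toReal (z x a u) : ((H.mdp z).trans x a u).toReal = H.weight z x a u := by
  simp only [mdp, PMF.ofFintype_apply]
  exact ENNReal.toReal_ofReal (H.weight_nonneg z x a u)

theorem reward_hub (z) {x} (a) (hx : H.IsHub x) : (H.mdp z).reward x a = 1 := by
  simp only [mdp, if_pos hx]

theorem IsLeaf.not_isHub {H : HubTree S A} {x} (hx : H.IsLeaf x) : ¬ H.IsHub x := hx.1

theorem reward_leaf (z) {x} (a) (hx : H.IsLeaf x) : (H.mdp z).reward x a = 0 := by
  simp only [mdp, if_neg hx.not_isHub, if_pos hx]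

theorem reward_inner (z) {x} (a) (h1 : ¬ H.IsHub x) (h2 : ¬ H.IsLeaf x) :
    (H.mdp z).reward x a = H.value := by
  simp only [mdp, if_neg h1, if_neg h2]

theorem sum_trans_hub (z) {x} (a) (f : Fin S → ℝ) (hx : H.IsHub x) :
    ∑ u, ((H.mdp z).trans x a u).toReal * f u
      = (1 - H.exitProb) * f (H.node (S - 1)) + H.exitProb * f (H.node 0) := by
  simp only [trans_toReal, sum_weight_mul, hubProb, rootProb, if_pos hx]
  ring

theorem sum_trans_leaf (z) {x} (a) (f : Fin S → ℝ) (hx : H.IsLeaf x) :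
    ∑ u, ((H.mdp z).trans x a u).toReal * f u
      = (H.δ + H.bonus z x a) * f (H.node (S - 1)) + H.δ * f (H.node 0)
        + (1 - 2 * H.δ - H.bonus z x a) * f x := by
  simp only [trans_toReal, sum_weight_mul, hubProb, rootProb, target, if_neg hx.not_isHub,
    if_pos hx, if_pos (Or.inr hx : H.IsHub x ∨ H.IsLeaf x)]
  ring

theorem sum_trans_inner (z) {x} (a) (f : Fin S → ℝ) (h1 : ¬ H.IsHub x) (h2 : ¬ H.IsLeaf x) :
    ∑ u, ((H.mdp z).trans x a u).toReal * f u
      = f (H.node (min (A * H.pos x + 1 + a) (S - 2))) := by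
  have h3 : ¬ (H.IsHub x ∨ H.IsLeaf x) := by tauto
  simp only [trans_toReal, sum_weight_mul, hubProb, rootProb, target, if_neg h1, if_neg h2,
    if_neg h3]
  ring

/-! ### Moving in the tree. -/

theorem pos_node {j : ℕ} (hj : j < S) : (H.pos (H.node j) : ℕ) = j := by
  simp only [node, Equiv.apply_symm_apply]
  omega

theorem node_pos (x : Fin S) : H.node (H.pos x) = x := by
  have := (H.pos x).2
  rw [node, Equiv.symm_apply_eq]
  ext
  simp only
  omega

theorem pos_hub : (H.pos (H.node (S - 1)) : ℕ) = S - 1 :=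
  H.pos_node (by have := H.two_le_S; omega)

theorem pos_root : (H.pos (H.node 0) : ℕ) = 0 := H.pos_node (by have := H.two_le_S; omega)

theorem isHub_hub : H.IsHub (H.node (S - 1)) := H.pos_hub

theorem not_isHub_root : ¬ H.IsHub (H.node 0) := by
  have := H.two_le_S
  rw [IsHub, pos_root]
  omega

theorem pos_child (i : ℕ) (a : Fin A) :
    (H.pos (H.node (min (A * i + 1 + a) (S - 2))) : ℕ) = min (A * i + 1 + a) (S - 2) :=
  H.pos_node (by have := H.two_le_S; omega)

/-- From an inner node every action leads to a child. -/
theorem exists_child {x : Fin S} (h1 : ¬ H.IsHub x) (h2 : ¬ H.IsLeaf x) (a : Fin A) :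
    ∃ b < A, min (A * (H.pos x : ℕ) + 1 + a) (S - 2) = A * H.pos x + 1 + b := by
  have h3 : A * (H.pos x : ℕ) + 1 < S - 1 := by
    by_contra h
    exact h2 ⟨h1, not_lt.1 h⟩
  refine ⟨min (a : ℕ) (S - 2 - (A * H.pos x + 1)), ?_, ?_⟩
  · have := a.2
    omega
  · omega

theorem heapDepth_le {i : ℕ} (hi : i ≤ S - 2) : (heapDepth A i : ℝ) ≤ H.depth :=
  Nat.cast_le.2 (heapDepth_mono hi)

theorem pos_le {x : Fin S} (hx : ¬ H.IsHub x) : (H.pos x : ℕ) ≤ S - 2 := by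
  have := (H.pos x).2
  rw [IsHub] at hx
  omega


/-- The action that leads from an inner node towards the node `y` of its subtree. -/
theorem exists_action {x : Fin S} {y : ℕ} (hy : y ≤ S - 2) (hx : HeapAncestor A y (H.pos x))
    (hxy : (H.pos x : ℕ) ≠ y) :
    ∃ a : Fin A, HeapAncestor A y (min (A * H.pos x + 1 + a) (S - 2)) := by
  obtain ⟨b, hb, h⟩ := hx.exists_child hxy
  refine ⟨⟨b, hb⟩, ?_⟩
  rwa [min_eq_left ((h.le (by omega)).trans hy)]

/-- A policy that leads from the root to the node `y`. -/
theorem exists_policy {y : ℕ} (hy : y ≤ S - 2) :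
    ∃ π : Fin S → Fin A, ∀ x, HeapAncestor A y (H.pos x) → (H.pos x : ℕ) ≠ y →
      HeapAncestor A y (min (A * H.pos x + 1 + π x) (S - 2)) := by
  have h : ∀ x, ∃ a : Fin A, HeapAncestor A y (H.pos x) → (H.pos x : ℕ) ≠ y →
      HeapAncestor A y (min (A * H.pos x + 1 + a) (S - 2)) := fun x => by
    by_cases h : HeapAncestor A y (H.pos x) ∧ (H.pos x : ℕ) ≠ y
    · obtain ⟨a, ha⟩ := H.exists_action hy h.1 h.2
      exact ⟨a, fun _ _ => ha⟩
    · exact ⟨⟨0, by have := H.two_le_A; omega⟩, fun h1 h2 => absurd ⟨h1, h2⟩ h⟩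
  choose π hπ using h
  exact ⟨π, hπ⟩

/-- Proper ancestors are not leaves. -/
theorem not_isLeaf_of_ancestor {x : Fin S} {y : ℕ} (hy : y ≤ S - 2)
    (hx : HeapAncestor A y (H.pos x)) (hxy : (H.pos x : ℕ) ≠ y) : ¬ H.IsLeaf x := by
  obtain ⟨b, hb, h⟩ := hx.exists_child hxy
  have := (h.le (by omega)).trans hy
  have := H.two_le_S
  rintro ⟨_, h3⟩
  omega

/-! ### The diameter of the hard instances. -/

/-- The potential `D - heapDepth` pays one unit per level of descent, under any policy. In a leaf it
is at least `9 * D / 10`, and leaving at rate at least `2 * δ = 4 / D` outweighs the unit of time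
together with the risk `δ * D = 2` of falling back to the root. -/
theorem hittingTime_hub_le (z) (x : Fin S) (π : Fin S → Fin A) :
    (H.mdp z).hittingTime π x (H.node (S - 1)) ≤ ENNReal.ofReal H.D := by
  classical
  set V : Fin S → ℝ := fun x => if H.IsHub x then 0 else H.D - heapDepth A (H.pos x) with hV
  have hD := H.D_pos
  have hd := H.ten_mul_depth_le
  have hVn : ∀ x, ¬ H.IsHub x → V x = H.D - heapDepth A (H.pos x) := fun x hx => if_neg hx
  have hVh : V (H.node (S - 1)) = 0 := if_pos H.isHub_hub
  have hV0 : ∀ x, 0 ≤ V x := fun x => by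
    by_cases hx : H.IsHub x
    · exact (if_pos hx).ge
    · rw [hVn x hx]
      linarith [H.heapDepth_le (H.pos_le hx)]
  have hVD : ∀ x, V x ≤ H.D := fun x => by
    by_cases hx : H.IsHub x
    · exact (if_pos hx).le.trans hD.le
    · rw [hVn x hx]
      linarith [(Nat.cast_nonneg (heapDepth A (H.pos x)) : (0 : ℝ) ≤ _)]
  refine ((H.mdp z).hittingTime_le_ofReal π _ hV0 (fun x hx => ?_) x).trans
    (ENNReal.ofReal_le_ofReal (hVD x))
  have h1 : ¬ H.IsHub x := fun h => hx (by rw [← H.node_pos x, h])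
  by_cases h2 : H.IsLeaf x
  · rw [H.sum_trans_leaf z _ _ h2, hVh]
    have h3 : 9 * H.D ≤ 10 * V x := by
      rw [hVn x h1]
      linarith [H.heapDepth_le (H.pos_le h1)]
    have h4 := mul_nonneg (H.bonus_nonneg z x (π x)) (hV0 x)
    have h5 := mul_le_mul_of_nonneg_left (hVD (H.node 0)) H.δ_pos.le
    have h6 := mul_le_mul_of_nonneg_left h3 H.δ_pos.le
    linarith [H.δ_mul]
  · rw [H.sum_trans_inner z _ _ h1 h2]
    obtain ⟨b, hb, hc⟩ := H.exists_child h1 h2 (π x)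
    have h3 : ¬ H.IsHub (H.node (min (A * H.pos x + 1 + π x) (S - 2))) := by
      have := H.two_le_S
      rw [IsHub, H.pos_child]
      omega
    rw [hVn _ h3, hVn _ h1, H.pos_child, hc, heapDepth_child hb]
    push_cast
    linarith

theorem exists_hittingTime_node_le (z) (x : Fin S) {y : ℕ} (hy : y ≤ S - 2) :
    ∃ π, (H.mdp z).hittingTime π x (H.node y) ≤ ENNReal.ofReal H.D := by
  classical
  obtain ⟨π, hπ⟩ := H.exists_policy hy
  refine ⟨π, ?_⟩
  have hS := H.two_le_S
  have hA := H.two_le_A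
  have hD := H.D_pos
  have hd := H.ten_mul_depth_le
  have hd0 := H.depth_nonneg
  have hyd := H.heapDepth_le hy
  have hy0 : (0 : ℝ) ≤ heapDepth A y := Nat.cast_nonneg _
  have hpy : (H.pos (H.node y) : ℕ) = y := H.pos_node (by omega)
  -- From the hub the cost is the mean exit time plus the descent to `y`; on the path it is the
  -- remaining descent. Off the path the potential is large enough to descend to a leaf and be
  -- thrown back to the hub or the root.
  set V : Fin S → ℝ := fun x => if H.IsHub x then H.D - H.depth + heapDepth A y else
    if HeapAncestor A y (H.pos x) then heapDepth A y - heapDepth A (H.pos x)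
    else H.D - heapDepth A (H.pos x) with hV
  have hVh : ∀ x, H.IsHub x → V x = H.D - H.depth + heapDepth A y := fun x hx => if_pos hx
  have hVa : ∀ x, ¬ H.IsHub x → HeapAncestor A y (H.pos x) →
      V x = heapDepth A y - heapDepth A (H.pos x) := fun x hx h => by
    simp only [hV, if_neg hx, if_pos h]
  have hVn : ∀ x, ¬ H.IsHub x → ¬ HeapAncestor A y (H.pos x) →
      V x = H.D - heapDepth A (H.pos x) := fun x hx h => by
    simp only [hV, if_neg hx, if_neg h]
  have hc0 : ∀ x, (0 : ℝ) ≤ heapDepth A (H.pos x) := fun x => Nat.cast_nonneg _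
  have hV0 : ∀ x, 0 ≤ V x := fun x => by
    by_cases hx : H.IsHub x
    · rw [hVh x hx]; linarith
    · by_cases h : HeapAncestor A y (H.pos x)
      · rw [hVa x hx h]
        have := Nat.cast_le (α := ℝ).2 (heapDepth_mono (A := A) (h.le (by omega)))
        linarith
      · rw [hVn x hx h]
        linarith [H.heapDepth_le (H.pos_le hx)]
  have hVD : ∀ x, V x ≤ H.D := fun x => by
    by_cases hx : H.IsHub x
    · rw [hVh x hx]; linarith
    · by_cases h : HeapAncestor A y (H.pos x)
      · rw [hVa x hx h]; linarith [hc0 x]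
      · rw [hVn x hx h]; linarith [hc0 x]
  have hVr : V (H.node 0) = heapDepth A y := by
    rw [hVa _ H.not_isHub_root, H.pos_root, heapDepth_zero]
    · simp
    · rw [H.pos_root]; exact HeapAncestor.root (by omega)
  refine ((H.mdp z).hittingTime_le_ofReal π _ hV0 (fun x hx => ?_) x).trans
    (ENNReal.ofReal_le_ofReal (hVD x))
  have hxy : (H.pos x : ℕ) ≠ y := fun h => hx (by rw [← H.node_pos x, h])
  by_cases h1 : H.IsHub x
  · rw [H.sum_trans_hub z _ _ h1, hVr, hVh _ H.isHub_hub, hVh _ h1]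
    linarith [H.exitProb_mul]
  by_cases h2 : H.IsLeaf x
  · have h3 : ¬ HeapAncestor A y (H.pos x) := fun h => H.not_isLeaf_of_ancestor hy h hxy h2
    have h4 : H.D - H.depth ≤ V x := by
      rw [hVn x h1 h3]
      linarith [H.heapDepth_le (H.pos_le h1)]
    rw [H.sum_trans_leaf z _ _ h2, hVr]
    have hb := H.bonus_nonneg z x (π x)
    have hb' := H.bonus_le z x (π x)
    have h5 := mul_le_mul_of_nonneg_left (hVD (H.node (S - 1))) (add_nonneg H.δ_pos.le hb)
    have h6 := mul_le_mul_of_nonneg_left hyd H.δ_pos.le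
    have h7 := mul_le_mul_of_nonneg_left h4
      (by linarith [H.δ_pos] : 0 ≤ 2 * H.δ + H.bonus z x (π x))
    have h8 := mul_le_mul_of_nonneg_left hd H.δ_pos.le
    have h9 := mul_le_mul_of_nonneg_left hd hb
    have h10 := mul_le_mul_of_nonneg_right hb' hD.le
    linarith [H.δ_mul, H.ε_mul_le]
  · rw [H.sum_trans_inner z _ _ h1 h2]
    obtain ⟨b, hb, hc⟩ := H.exists_child h1 h2 (π x)
    have h3 : ¬ H.IsHub (H.node (min (A * H.pos x + 1 + π x) (S - 2))) := by
      rw [IsHub, H.pos_child]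
      omega
    by_cases h : HeapAncestor A y (H.pos x)
    · have h4 := hπ x h hxy
      rw [hVa _ h3 (by rwa [H.pos_child]), hVa _ h1 h, H.pos_child, hc, heapDepth_child hb]
      push_cast
      linarith
    · have h4 : ¬ HeapAncestor A y (min (A * H.pos x + 1 + π x) (S - 2)) := fun h5 =>
        h (HeapAncestor.step hb (hc ▸ h5))
      rw [hVn _ h3 (by rwa [H.pos_child]), hVn _ h1 h, H.pos_child, hc, heapDepth_child hb]
      push_cast
      linarith

/-- Node `S - 2` is deepest, so no policy beats the mean exit time of the hub followed by one level
per step. -/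
theorem le_hittingTime_last (z) (π : Fin S → Fin A) :
    ENNReal.ofReal H.D ≤ (H.mdp z).hittingTime π (H.node (S - 1)) (H.node (S - 2)) := by
  classical
  have hS := H.two_le_S
  have hD := H.D_pos
  have hd := H.ten_mul_depth_le
  have hd0 := H.depth_nonneg
  set V : Fin S → ℝ := fun x => if H.IsHub x then H.D else H.depth - heapDepth A (H.pos x) with hV
  have hVh : ∀ x, H.IsHub x → V x = H.D := fun x hx => if_pos hx
  have hVn : ∀ x, ¬ H.IsHub x → V x = H.depth - heapDepth A (H.pos x) := fun x hx => if_neg hx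
  have hc0 : ∀ x, (0 : ℝ) ≤ heapDepth A (H.pos x) := fun x => Nat.cast_nonneg _
  have hVr : V (H.node 0) = H.depth := by
    rw [hVn _ H.not_isHub_root, H.pos_root, heapDepth_zero]
    simp
  have hpl : (H.pos (H.node (S - 2)) : ℕ) = S - 2 := H.pos_node (by omega)
  have hV0 : ∀ x, 0 ≤ V x := fun x => by
    by_cases hx : H.IsHub x
    · rw [hVh x hx]; exact hD.le
    · rw [hVn x hx]
      linarith [H.heapDepth_le (H.pos_le hx)]
  have hVD : ∀ x, V x ≤ H.D := fun x => by
    by_cases hx : H.IsHub x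
    · rw [hVh x hx]
    · rw [hVn x hx]; linarith [hc0 x]
  rw [← hVh _ H.isHub_hub]
  refine (H.mdp z).ofReal_le_hittingTime π _ hV0 hVD ?_ (fun x _ => ?_) _
  · rw [hVn, hpl, depth, sub_self]
    rw [IsHub, hpl]
    omega
  by_cases h1 : H.IsHub x
  · rw [H.sum_trans_hub z _ _ h1, hVr, hVh _ H.isHub_hub, hVh _ h1]
    linarith [H.exitProb_mul]
  by_cases h2 : H.IsLeaf x
  · rw [H.sum_trans_leaf z _ _ h2, hVr, hVh _ H.isHub_hub]
    have h3 : V x ≤ H.depth := by rw [hVn x h1]; linarith [hc0 x]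
    have h4 := mul_le_mul_of_nonneg_left h3 H.δ_pos.le
    have h5 := mul_le_mul_of_nonneg_left (hVD x)
      (add_nonneg H.δ_pos.le (H.bonus_nonneg z x (π x)))
    linarith
  · rw [H.sum_trans_inner z _ _ h1 h2]
    obtain ⟨b, hb, hc⟩ := H.exists_child h1 h2 (π x)
    have h3 : ¬ H.IsHub (H.node (min (A * H.pos x + 1 + π x) (S - 2))) := by
      rw [IsHub, H.pos_child]
      omega
    rw [hVn _ h3, hVn _ h1, H.pos_child, hc, heapDepth_child hb]
    push_cast
    linarith

theorem diameter_mdp (z) : (H.mdp z).diameter = ENNReal.ofReal H.D := by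
  have hS := H.two_le_S
  have hA := H.two_le_A
  apply le_antisymm
  · refine iSup_le fun x => iSup_le fun y => iSup_le fun _ => ?_
    by_cases hy : H.IsHub y
    · rw [← H.node_pos y, hy]
      exact (iInf_le _ fun _ => ⟨0, by omega⟩).trans (H.hittingTime_hub_le z x _)
    · obtain ⟨π, hπ⟩ := H.exists_hittingTime_node_le z x (H.pos_le hy)
      rw [H.node_pos] at hπ
      exact (iInf_le _ π).trans hπ
  · have hne : H.node (S - 1) ≠ H.node (S - 2) := fun h => by
      have h1 := H.pos_hub
      rw [h, H.pos_node (by omega)] at h1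
      omega
    refine le_trans (le_iInf fun π => H.le_hittingTime_last z π) ?_
    exact le_iSup_of_le (H.node (S - 1)) (le_iSup_of_le (H.node (S - 2))
      (le_iSup_of_le hne le_rfl))

/-! ### The optimal average reward. -/

/-- The policy steers to the special leaf and plays the special action there. A subsolution of the
Poisson equation suffices, because a lower bound on the regret only needs a lower bound on the
optimum. -/
theorem value_le_optimalGain {y : Fin S} (hy : H.IsLeaf y) (a : Fin A) (s : Fin S) :
    H.value ≤ (H.mdp (some (y, a))).optimalGain s := by
  classical
  have hA := H.two_le_A
  have hyS := H.pos_le hy.not_isHub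
  obtain ⟨π, hπ⟩ := H.exists_policy hyS
  -- Nodes off the path get the bias `-K`. An ordinary leaf lacks the gain `ε * hubBias`, and the
  -- jumps out of it at rate `2 * δ` recover at least `2 * δ * K`, twice that amount.
  set K : ℝ := H.ε * H.hubBias / H.δ with hK
  have hδ := H.δ_pos
  have hKδ : K * H.δ = H.ε * H.hubBias := div_mul_cancel₀ _ hδ.ne'
  have hK0 : 0 < K := div_pos (mul_pos H.ε_pos H.hubBias_pos) hδ
  set h : Fin S → ℝ := fun x => if H.IsHub x then H.hubBias else
    if HeapAncestor A (H.pos y) (H.pos x) then 0 else -K with hh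
  have hhub : h (H.node (S - 1)) = H.hubBias := if_pos H.isHub_hub
  have hroot : h (H.node 0) = 0 := by
    have : HeapAncestor A (H.pos y) 0 := HeapAncestor.root (by omega)
    simp only [hh, if_neg H.not_isHub_root, H.pos_root, if_pos this]
  have hge : ∀ x, -K ≤ h x := fun x => by
    simp only [hh]
    split_ifs <;> linarith [H.hubBias_pos]
  refine (H.mdp (some (y, a))).le_optimalGain (fun x => if x = y then a else π x) (h := h)
    (fun x => ?_) s
  by_cases h1 : H.IsHub x
  · rw [H.sum_trans_hub _ _ _ h1, H.reward_hub _ _ h1, hhub, hroot,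
      show h x = H.hubBias from if_pos h1]
    linarith [H.value_eq]
  by_cases h2 : H.IsLeaf x
  · rw [H.sum_trans_leaf _ _ _ h2, H.reward_leaf _ _ h2, hhub, hroot]
    by_cases hxy : x = y
    · have h3 : h x = 0 := by
        simp only [hh, hxy, if_neg hy.not_isHub, if_pos HeapAncestor.refl]
      have h4 : H.bonus (some (y, a)) x (if x = y then a else π x) = H.ε := by
        simp [bonus, hxy]
      rw [h3, h4]
      linarith [show H.value = (H.δ + H.ε) * H.hubBias from rfl]
    · have h3 : ¬ HeapAncestor A (H.pos y) (H.pos x) := fun h =>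
        H.not_isLeaf_of_ancestor hyS h
          (fun h' => hxy (H.pos.injective (Fin.ext h'))) h2
      have h4 : h x = -K := by simp only [hh, if_neg h1, if_neg h3]
      rw [h4]
      have hb := H.bonus_nonneg (some (y, a)) x (if x = y then a else π x)
      have h5 := mul_nonneg hb hK0.le
      have h6 := mul_nonneg hb H.hubBias_pos.le
      have h7 := mul_pos hδ hK0
      linarith [show H.value = (H.δ + H.ε) * H.hubBias from rfl]
  · rw [H.sum_trans_inner _ _ _ h1 h2, H.reward_inner _ _ h1 h2]
    by_cases hx : HeapAncestor A (H.pos y) (H.pos x)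
    · have hxy : x ≠ y := fun h => h2 (h ▸ hy)
      have h3 := hπ x hx fun h' => hxy (H.pos.injective (Fin.ext h'))
      have h4 : ¬ H.IsHub (H.node (min (A * H.pos x + 1 + π x) (S - 2))) := by
        have := H.two_le_S
        rw [IsHub, H.pos_child]
        omega
      have h5 : h x = 0 := by simp only [hh, if_neg h1, if_pos hx]
      rw [if_neg hxy, h5]
      simp only [hh, if_neg h4, H.pos_child, if_pos h3]
      exact le_rfl
    · have h5 : h x = -K := by simp only [hh, if_neg h1, if_neg hx]
      rw [h5]
      linarith [hge (H.node (min (A * H.pos x + 1 + (if x = y then a else π x : Fin A)) (S - 2)))]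


/-! ### The Poisson equation and the regret decomposition. -/

open scoped Classical in
/-- The bias function of the hard instances. -/
def bias (x : Fin S) : ℝ := if H.IsHub x then H.hubBias else 0

open scoped Classical in
/-- The suboptimality gap of the action `a` in the state `x`. -/
def gap (z : Option (Fin S × Fin A)) (x : Fin S) (a : Fin A) : ℝ :=
  if H.IsLeaf x then (H.ε - H.bonus z x a) * H.hubBias else 0

open scoped Classical in
def leafIndicator (x : Fin S) (_a : Fin A) : ℝ := if H.IsLeaf x then 1 else 0

theorem gap_nonneg (z x a) : 0 ≤ H.gap z x a := by
  unfold gap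
  split_ifs
  · exact mul_nonneg (by linarith [H.bonus_le z x a]) H.hubBias_pos.le
  · exact le_rfl

theorem bias_nonneg (x) : 0 ≤ H.bias x := by
  unfold bias
  split_ifs
  · exact H.hubBias_pos.le
  · exact le_rfl

/-- The Poisson equation of the hard instances. -/
theorem value_add_bias (z x a) : H.value + H.bias x = (H.mdp z).reward x a
    + (∑ u, ((H.mdp z).trans x a u).toReal * H.bias u + H.gap z x a) := by
  have hhub : H.bias (H.node (S - 1)) = H.hubBias := if_pos H.isHub_hub
  have hroot : H.bias (H.node 0) = 0 := if_neg H.not_isHub_root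
  by_cases h1 : H.IsHub x
  · have h2 : ¬ H.IsLeaf x := fun h => h.not_isHub h1
    rw [H.sum_trans_hub _ _ _ h1, H.reward_hub _ _ h1, hhub, hroot, bias, if_pos h1, gap,
      if_neg h2]
    linarith [H.value_eq]
  by_cases h2 : H.IsLeaf x
  · rw [H.sum_trans_leaf _ _ _ h2, H.reward_leaf _ _ h2, hhub, hroot, bias, if_neg h1, gap,
      if_pos h2]
    linarith [show H.value = (H.δ + H.ε) * H.hubBias from rfl]
  · have h4 : ¬ H.IsHub (H.node (min (A * H.pos x + 1 + a) (S - 2))) := by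
      have := H.two_le_S
      rw [IsHub, H.pos_child]
      omega
    rw [H.sum_trans_inner _ _ _ h1 h2, H.reward_inner _ _ h1 h2, bias, if_neg h1, bias,
      if_neg h4, gap, if_neg h2]
    ring

variable (alg : LearningAlgorithm S A) (s₁ : Fin S)

/-- The process whose special pair at the step `t` is `ζ t`. -/
def process (ζ : ℕ → Option (Fin S × Fin A)) : NonstationaryMDP S A := fun t => H.mdp (ζ t)

/-- Expectation of the Poisson equation along the trajectory, with the Markov property identifying
the expected next bias; the bias terms telescope over time. -/
theorem value_sub_expectedReward (ζ : ℕ → Option (Fin S × Fin A)) (t : ℕ) :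
    H.value - (H.process ζ).expectedReward alg s₁ t
      = (H.process ζ).occupation alg s₁ t (H.gap (ζ t))
        + ((H.process ζ).stateMean alg s₁ (t + 1) H.bias
          - (H.process ζ).stateMean alg s₁ t H.bias) := by
  have h1 := (H.process ζ).occupation_add alg s₁ t (fun _ _ => H.value) (fun s _ => H.bias s)
  have h2 : (H.process ζ).occupation alg s₁ t (fun s _ => H.value + H.bias s)
      = (H.process ζ).occupation alg s₁ t (fun s a => (H.process ζ t).reward s a
        + (∑ u, ((H.process ζ t).trans s a u).toReal * H.bias u + H.gap (ζ t) s a)) := by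
    congr 1
    funext s a
    exact H.value_add_bias (ζ t) s a
  rw [h1, NonstationaryMDP.occupation_add, NonstationaryMDP.occupation_add,
    ← NonstationaryMDP.stateMean_succ, ← NonstationaryMDP.expectedReward_eq_occupation] at h2
  rw [NonstationaryMDP.occupation_state (h := fun _ => H.value),
    NonstationaryMDP.stateMean_const, NonstationaryMDP.occupation_state] at h2
  linarith

/-- The bias is nonnegative and vanishes away from the hub, so a start outside the hub makes the
telescoped boundary term nonnegative. -/
theorem sum_gap_le_sum_regret (hs : ¬ H.IsHub s₁) (ζ : ℕ → Option (Fin S × Fin A)) (T : ℕ) :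
    ∑ t ∈ Finset.range T, (H.process ζ).occupation alg s₁ t (H.gap (ζ t))
      ≤ ∑ t ∈ Finset.range T, (H.value - (H.process ζ).expectedReward alg s₁ t) := by
  simp only [value_sub_expectedReward, Finset.sum_add_distrib]
  rw [Finset.sum_range_sub fun t => (H.process ζ).stateMean alg s₁ t H.bias,
    NonstationaryMDP.stateMean_zero, show H.bias s₁ = 0 from if_neg hs, sub_zero]
  have := (H.process ζ).stateMean_mono alg s₁ T H.bias_nonneg
  rw [NonstationaryMDP.stateMean_const] at this
  linarith

/-! ### Time spent in the leaves. -/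

open scoped Classical in
/-- A bound on the time until the next visit to a leaf. -/
def delay (x : Fin S) : ℝ := if H.IsHub x then H.D else H.depth - heapDepth A (H.pos x)

theorem delay_nonneg (x) : 0 ≤ H.delay x := by
  unfold delay
  split_ifs with hx
  · exact H.D_pos.le
  · linarith [H.heapDepth_le (H.pos_le hx)]

theorem delay_le (x) : H.delay x ≤ H.D := by
  have : (0 : ℝ) ≤ heapDepth A (H.pos x) := Nat.cast_nonneg _
  unfold delay
  split_ifs with hx
  · exact le_rfl
  · linarith [H.ten_mul_depth_le, H.depth_nonneg]

/-- Outside the leaves the delay drops by one per step in expectation. In a leaf the increase is at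
most `1 + δ * D + ε * D + δ * depth ≤ 1 + 2 + 1 + 1/5`, below the charge of 5. -/
theorem sum_trans_delay_le (z x a) :
    1 + ∑ u, ((H.mdp z).trans x a u).toReal * H.delay u
      ≤ H.delay x + 5 * H.leafIndicator x a := by
  have hhub : H.delay (H.node (S - 1)) = H.D := if_pos H.isHub_hub
  have hroot : H.delay (H.node 0) = H.depth := by
    rw [delay, if_neg H.not_isHub_root, H.pos_root, heapDepth_zero]
    simp
  by_cases h1 : H.IsHub x
  · have h2 : ¬ H.IsLeaf x := fun h => h.not_isHub h1
    rw [H.sum_trans_hub _ _ _ h1, hhub, hroot, delay, if_pos h1, leafIndicator, if_neg h2]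
    linarith [H.exitProb_mul]
  by_cases h2 : H.IsLeaf x
  · rw [H.sum_trans_leaf _ _ _ h2, hhub, hroot, leafIndicator, if_pos h2]
    have hb := H.bonus_nonneg z x a
    have h3 := mul_le_mul_of_nonneg_right (H.bonus_le z x a) H.D_pos.le
    have h4 := mul_nonneg H.δ_pos.le (H.delay_nonneg x)
    have h5 := mul_nonneg hb (H.delay_nonneg x)
    have h6 := mul_le_mul_of_nonneg_left H.ten_mul_depth_le H.δ_pos.le
    linarith [H.δ_mul, H.ε_mul_le]
  · obtain ⟨b, hb, hc⟩ := H.exists_child h1 h2 a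
    have h4 : ¬ H.IsHub (H.node (min (A * H.pos x + 1 + a) (S - 2))) := by
      have := H.two_le_S
      rw [IsHub, H.pos_child]
      omega
    rw [H.sum_trans_inner _ _ _ h1 h2, delay, delay, if_neg h4, if_neg h1, H.pos_child, hc,
      heapDepth_child hb, leafIndicator, if_neg h2]
    push_cast
    linarith

/-- The learner cannot avoid the leaves. -/
theorem le_sum_leafIndicator (ζ : ℕ → Option (Fin S × Fin A)) (t₀ L : ℕ) :
    (L : ℝ) - H.D
      ≤ 5 * ∑ t ∈ Finset.Ico t₀ (t₀ + L), (H.process ζ).occupation alg s₁ t H.leafIndicator := by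
  set e := fun t => (H.process ζ).stateMean alg s₁ t H.delay with he
  have hstep : ∀ t, 1 + e (t + 1)
      ≤ e t + 5 * (H.process ζ).occupation alg s₁ t H.leafIndicator := fun t => by
    have h := (H.process ζ).occupation_mono alg s₁ t fun x a => H.sum_trans_delay_le (ζ t) x a
    rw [NonstationaryMDP.occupation_add, NonstationaryMDP.occupation_add,
      NonstationaryMDP.occupation_smul, NonstationaryMDP.occupation_state,
      NonstationaryMDP.occupation_state, NonstationaryMDP.stateMean_const] at h
    have h' := (H.process ζ).stateMean_succ alg s₁ t H.delay
    simp only [process] at h' h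
    simp only [he]
    rw [h']
    exact h
  have hsum : ∀ n : ℕ, (n : ℝ) + e (t₀ + n) ≤ e t₀ + 5 * ∑ t ∈ Finset.Ico t₀ (t₀ + n),
      (H.process ζ).occupation alg s₁ t H.leafIndicator := by
    intro n
    induction n with
    | zero => simp
    | succ n ih =>
      rw [← add_assoc, Finset.sum_Ico_succ_top (Nat.le_add_right _ _)]
      push_cast
      linarith [hstep (t₀ + n)]
  have h1 : e t₀ ≤ H.D := by
    have := (H.process ζ).stateMean_mono alg s₁ t₀ H.delay_le
    rwa [NonstationaryMDP.stateMean_const] at this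
  have h2 : 0 ≤ e (t₀ + L) := by
    have := (H.process ζ).stateMean_mono alg s₁ (t₀ + L) H.delay_nonneg
    rwa [NonstationaryMDP.stateMean_const] at this
  linarith [hsum L]

/-! #### Comparison of the instances -/

theorem hubProb_of_isLeaf (z) {x} (a) (hx : H.IsLeaf x) :
    H.hubProb z x a = H.δ + H.bonus z x a := by
  simp only [hubProb, if_neg hx.not_isHub, if_pos hx]

theorem rootProb_of_isLeaf {x} (hx : H.IsLeaf x) : H.rootProb x = H.δ := by
  simp only [rootProb, if_neg hx.not_isHub, if_pos hx]

theorem weight_congr {z z' x a} (h : H.IsLeaf x → H.bonus z x a = H.bonus z' x a) :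
    H.weight z x a = H.weight z' x a := by
  have : H.hubProb z x a = H.hubProb z' x a := by
    unfold hubProb
    split_ifs with h1 h2
    · rfl
    · rw [h h2]
    · rfl
  funext u
  rw [weight, weight, this]

theorem weight_sub_weight (z z' x a u) (hx : H.IsLeaf x) :
    H.weight z x a u - H.weight z' x a u = (H.bonus z x a - H.bonus z' x a) *
      ((if u = H.node (S - 1) then 1 else 0) - (if u = x then 1 else 0)) := by
  rw [weight, weight, H.hubProb_of_isLeaf z a hx, H.hubProb_of_isLeaf z' a hx,
    show H.target x a = x from if_pos (Or.inr hx)]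
  ring

/-- Since `ε ≤ δ`, the bonus at most doubles the jump rate to the hub, and the probability of
staying remains bounded away from zero. It provides absolute continuity between any two instances.
-/
theorem weight_le_two_mul (z z' x a u) : H.weight z x a u ≤ 2 * H.weight z' x a u := by
  by_cases hx : H.IsLeaf x
  · have h : ∀ p : Prop, [Decidable p] → (0 : ℝ) ≤ if p then 1 else 0 := fun p _ => by
      split_ifs <;> norm_num
    have hδε : H.ε ≤ H.δ := by nlinarith [H.δ_mul, H.ε_mul_le, H.D_pos]
    rw [weight, weight, H.hubProb_of_isLeaf z a hx, H.hubProb_of_isLeaf z' a hx,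
      H.rootProb_of_isLeaf hx, mul_add, mul_add, ← mul_assoc, ← mul_assoc, ← mul_assoc]
    have := H.bonus_nonneg z x a
    have := H.bonus_nonneg z' x a
    have := H.bonus_le z x a
    have := H.bonus_le z' x a
    have := H.δ_pos
    have := H.δ_le
    have := H.ε_le
    exact add_le_add (add_le_add (mul_le_mul_of_nonneg_right (by linarith) (h _))
      (mul_le_mul_of_nonneg_right (by linarith) (h _)))
      (mul_le_mul_of_nonneg_right (by linarith) (h _))
  · rw [H.weight_congr (z := z) (z' := z') fun h => absurd h hx]
    linarith [H.weight_nonneg z' x a u]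

theorem trans_eq_zero (z z' x a u) (h : (H.mdp z').trans x a u = 0) :
    (H.mdp z).trans x a u = 0 := by
  have h1 : H.weight z' x a u = 0 := by rw [← trans_toReal, h, ENNReal.toReal_zero]
  have h2 : H.weight z x a u = 0 :=
    le_antisymm (by linarith [H.weight_le_two_mul z z' x a u]) (H.weight_nonneg z x a u)
  rw [← trans_toReal] at h2
  exact ((ENNReal.toReal_eq_zero_iff _).1 h2).resolve_right (PMF.apply_ne_top _ _)

theorem sum_abs_weight_sub_le (z z' x a) :
    ∑ u, |H.weight z x a u - H.weight z' x a u| ≤ 2 * H.ε := by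
  by_cases hx : H.IsLeaf x
  · have hb : |H.bonus z x a - H.bonus z' x a| ≤ H.ε := by
      rw [abs_le]
      constructor <;> linarith [H.bonus_nonneg z x a, H.bonus_nonneg z' x a, H.bonus_le z x a,
        H.bonus_le z' x a]
    have hu : ∀ u, |H.weight z x a u - H.weight z' x a u|
        ≤ H.ε * (if u = H.node (S - 1) then 1 else 0) + H.ε * (if u = x then 1 else 0) := by
      intro u
      rw [H.weight_sub_weight z z' x a u hx, abs_mul, ← mul_add]
      refine mul_le_mul hb ?_ (abs_nonneg _) H.ε_pos.le
      split_ifs <;> norm_num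
    refine (Finset.sum_le_sum fun u _ => hu u).trans ?_
    simp only [Finset.sum_add_distrib, ← Finset.mul_sum, Finset.sum_ite_eq', Finset.mem_univ,
      if_true]
    linarith
  · rw [H.weight_congr (z := z) (z' := z') fun h => absurd h hx]
    simp only [sub_self, abs_zero, Finset.sum_const_zero]
    linarith [H.ε_pos]

-- Chi-squared bound: the hub contributes at most `ε² / δ = ε² * D / 2` and the leaf itself at most
-- `2 * ε²`. The first law is the one without a special pair, so that the chain rule counts trials
-- under a reference independent of `z`.
open scoped Classical in
theorem relativeEntropy_trans_le (z : Fin S × Fin A) (x a) :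
    ∑ u, ((H.mdp none).trans x a u).toReal * Real.log
      (((H.mdp none).trans x a u).toReal / ((H.mdp (some z)).trans x a u).toReal)
      ≤ H.ε ^ 2 * H.D * (if (x, a) = z ∧ H.IsLeaf x then 1 else 0) := by
  simp only [trans_toReal]
  by_cases h : (x, a) = z ∧ H.IsLeaf x
  · obtain ⟨rfl, hx⟩ := h
    have hb0 : H.bonus none x a = 0 := by simp [bonus]
    have hb1 : H.bonus (some (x, a)) x a = H.ε := by simp [bonus]
    have hind : ∀ p : Prop, [Decidable p] → (0 : ℝ) ≤ if p then 1 else 0 := fun p _ => by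
      split_ifs <;> norm_num
    refine (sum_mul_log_le_sum_sq_div _ _ (H.weight_nonneg none x a)
      (H.weight_nonneg (some (x, a)) x a) (H.sum_weight _ x a) (H.sum_weight _ x a)
      fun u hu => le_antisymm (by linarith [H.weight_le_two_mul none (some (x, a)) x a u])
        (H.weight_nonneg _ x a u)).trans ?_
    have hxhub : x ≠ H.node (S - 1) := fun h => hx.not_isHub (h ▸ H.isHub_hub)
    have hwh : H.δ ≤ H.weight (some (x, a)) x a (H.node (S - 1)) := by
      rw [weight, H.hubProb_of_isLeaf _ a hx, hb1, if_pos rfl, H.rootProb_of_isLeaf hx,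
        show H.target x a = x from if_pos (Or.inr hx), if_neg hxhub.symm]
      have := mul_nonneg H.δ_pos.le (hind (H.node (S - 1) = H.node 0))
      linarith [H.ε_pos]
    have hwx : 1 / 2 ≤ H.weight (some (x, a)) x a x := by
      rw [weight, H.hubProb_of_isLeaf _ a hx, hb1, if_neg hxhub, H.rootProb_of_isLeaf hx,
        show H.target x a = x from if_pos (Or.inr hx), if_pos rfl]
      have := mul_nonneg H.δ_pos.le (hind (x = H.node 0))
      linarith [H.ε_le, H.δ_le]
    have hu : ∀ u, (H.weight none x a u - H.weight (some (x, a)) x a u) ^ 2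
        / H.weight (some (x, a)) x a u
        ≤ H.ε ^ 2 * (H.D / 2) * (if u = H.node (S - 1) then 1 else 0)
          + H.ε ^ 2 * 2 * (if u = x then 1 else 0) := fun u => by
      rw [H.weight_sub_weight _ _ x a u hx, hb0, hb1]
      by_cases hu1 : u = H.node (S - 1)
      · subst hu1
        rw [if_pos rfl, if_neg hxhub.symm, div_le_iff₀ (lt_of_lt_of_le H.δ_pos hwh)]
        have h1 := mul_le_mul_of_nonneg_left hwh
          (mul_nonneg (sq_nonneg H.ε) (by linarith [H.D_pos] : 0 ≤ H.D / 2))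
        have h2 : H.ε ^ 2 * (H.D / 2) * H.δ = H.ε ^ 2 := by
          rw [mul_assoc, div_mul_eq_mul_div, mul_comm H.D, H.δ_mul]; ring
        linarith
      · by_cases hu2 : u = x
        · subst hu2
          rw [if_neg hu1, if_pos rfl, div_le_iff₀ (by linarith)]
          have h1 := mul_le_mul_of_nonneg_left hwx (sq_nonneg H.ε)
          linarith
        · simp [hu1, hu2]
    refine (Finset.sum_le_sum fun u _ => hu u).trans ?_
    simp only [Finset.sum_add_distrib, ← Finset.mul_sum, Finset.sum_ite_eq', Finset.mem_univ,
      if_true, and_self, hx]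
    nlinarith [mul_le_mul_of_nonneg_left H.le_D (sq_nonneg H.ε), sq_nonneg H.ε]
  · rw [if_neg h, mul_zero]
    have : H.weight none x a = H.weight (some z) x a := H.weight_congr fun hx => by
      simp only [bonus, reduceCtorEq, if_false, Option.some.injEq]
      rw [if_neg fun hz => h ⟨hz.symm, hx⟩]
    rw [this]
    refine le_of_eq (Finset.sum_eq_zero fun u _ => ?_)
    by_cases h0 : H.weight (some z) x a u = 0
    · simp [h0]
    · simp [div_self h0]

/-! #### The leaves -/

open scoped Classical in
def leafPairs : Finset (Fin S × Fin A) := Finset.univ.filter fun z => H.IsLeaf z.1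

theorem mem_leafPairs {z} : z ∈ H.leafPairs ↔ H.IsLeaf z.1 := by simp [leafPairs]

/-- Since `A ≥ 2`, every node numbered at least `(S - 1) / 2` has its would-be children outside the
tree. -/
theorem mul_le_card_leafPairs : S * A ≤ 4 * H.leafPairs.card := by
  classical
  have hS := H.two_le_S
  have hA := H.two_le_A
  have h1 : ((Finset.Ico ((S - 1) / 2) (S - 1)).image H.node) ×ˢ (Finset.univ : Finset (Fin A))
      ⊆ H.leafPairs := by
    intro z hz
    simp only [Finset.mem_product, Finset.mem_image, Finset.mem_Ico, Finset.mem_univ,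
      and_true] at hz
    obtain ⟨i, ⟨h2, h3⟩, h4⟩ := hz
    rw [mem_leafPairs, ← h4, IsLeaf, H.pos_node (by omega)]
    have : 2 * i ≤ A * i := Nat.mul_le_mul_right i hA
    omega
  have h2 := Finset.card_le_card h1
  rw [Finset.card_product, Finset.card_image_of_injOn, Nat.card_Ico, Finset.card_univ,
    Fintype.card_fin] at h2
  · have h3 : S ≤ 4 * (S - 1 - (S - 1) / 2) := by omega
    calc S * A ≤ 4 * (S - 1 - (S - 1) / 2) * A := Nat.mul_le_mul_right A h3
      _ ≤ 4 * H.leafPairs.card := by rw [mul_assoc]; exact Nat.mul_le_mul_left 4 h2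
  · intro i hi j hj hij
    simp only [Finset.coe_Ico, Set.mem_Ico] at hi hj
    have := congrArg (fun x => (H.pos x : ℕ)) hij
    simpa [H.pos_node (show i < S by omega), H.pos_node (show j < S by omega)] using this

theorem exists_isLeaf : ∃ y, H.IsLeaf y := by
  have hS := H.two_le_S
  have hA := H.two_le_A
  refine ⟨H.node (S - 2), ?_⟩
  rw [IsLeaf, H.pos_node (by omega)]
  have : 2 * (S - 2) ≤ A * (S - 2) := Nat.mul_le_mul_right _ hA
  omega

/-- The quarter bound above can degenerate to 1 for the smallest `S` and `A`; two pairs are needed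
for one of them to carry at most half of the leaf visits. -/
theorem two_le_card_leafPairs : 2 ≤ H.leafPairs.card := by
  classical
  obtain ⟨y, hy⟩ := H.exists_isLeaf
  have h1 : ({y} : Finset (Fin S)) ×ˢ (Finset.univ : Finset (Fin A)) ⊆ H.leafPairs := by
    intro z hz
    simp only [Finset.mem_product, Finset.mem_singleton, Finset.mem_univ, and_true] at hz
    rw [mem_leafPairs, hz]
    exact hy
  have h2 := Finset.card_le_card h1
  rw [Finset.card_product, Finset.card_singleton, Finset.card_univ, Fintype.card_fin,
    one_mul] at h2
  exact H.two_le_A.trans h2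


/-! ### The lower bound in one window. -/

open scoped Classical in
def pairIndicator (z : Fin S × Fin A) (x : Fin S) (a : Fin A) : ℝ :=
  if (x, a) = z ∧ H.IsLeaf x then 1 else 0

theorem pairIndicator_nonneg (z x a) : 0 ≤ H.pairIndicator z x a := by
  unfold pairIndicator; split_ifs <;> norm_num

theorem pairIndicator_le (z x a) : H.pairIndicator z x a ≤ H.leafIndicator x a := by
  unfold pairIndicator leafIndicator
  split_ifs with h1 h2 <;> first | exact absurd h1.2 h2 | norm_num

theorem leafIndicator_le_one (x a) : H.leafIndicator x a ≤ 1 := by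
  unfold leafIndicator; split_ifs <;> norm_num

theorem sum_pairIndicator (x a) :
    ∑ z ∈ H.leafPairs, H.pairIndicator z x a = H.leafIndicator x a := by
  classical
  by_cases hx : H.IsLeaf x
  · rw [Finset.sum_eq_single_of_mem (x, a) (H.mem_leafPairs.2 hx)]
    · simp [pairIndicator, leafIndicator, hx]
    · intro z _ hz
      simp [pairIndicator, Ne.symm hz]
  · simp [pairIndicator, leafIndicator, hx]

theorem gap_eq (z : Fin S × Fin A) (x a) : H.gap (some z) x a
    = H.ε * H.hubBias * (H.leafIndicator x a + -1 * H.pairIndicator z x a) := by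
  by_cases hx : H.IsLeaf x
  · by_cases hz : (x, a) = z
    · simp [gap, bonus, leafIndicator, pairIndicator, hx, hz]
    · simp [gap, bonus, leafIndicator, pairIndicator, hx, hz, Ne.symm hz]
  · simp [gap, leafIndicator, pairIndicator, hx]

theorem occupation_nonneg (M : NonstationaryMDP S A) (t : ℕ) {f : Fin S → Fin A → ℝ}
    (hf : ∀ x a, 0 ≤ f x a) : 0 ≤ M.occupation alg s₁ t f := by
  have := M.occupation_mono alg s₁ t hf
  rwa [M.occupation_state alg s₁ t fun _ => 0, M.stateMean_const] at this

/-- The learner misses the special pair in a window of length `L`, for a suitable choice of the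
pair. -/
theorem exists_special_pair (b : ℕ → Option (Fin S × Fin A)) (t₀ L : ℕ) (hL : 4 * H.D ≤ L)
    (hε : 6400 * (H.ε ^ 2 * H.D * L) ≤ (S : ℝ) * A) :
    ∃ z ∈ H.leafPairs, H.ε * H.hubBias * (L / 40) ≤ ∑ t ∈ Finset.Ico t₀ (t₀ + L),
      (H.process fun t => if t ∈ Finset.Ico t₀ (t₀ + L) then some z else b t).occupation
        alg s₁ t (H.gap (some z)) := by
  classical
  set I := Finset.Ico t₀ (t₀ + L) with hI
  -- The reference process has no special pair in the window, so its visit counts can be averaged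
  -- over all candidates.
  set M₀ := H.process fun t => if t ∈ I then none else b t with hM₀
  set N := ∑ t ∈ I, M₀.occupation alg s₁ t H.leafIndicator with hN
  set n : Fin S × Fin A → ℝ := fun z => ∑ t ∈ I, M₀.occupation alg s₁ t (H.pairIndicator z) with hn
  set c : ℝ := Nat.cast H.leafPairs.card with hc
  have hc2 : (2 : ℝ) ≤ c := by
    rw [hc]; exact_mod_cast H.two_le_card_leafPairs
  have hcSA : (S : ℝ) * A ≤ 4 * c := by
    rw [hc]; exact_mod_cast H.mul_le_card_leafPairs
  have hNge : (L : ℝ) - H.D ≤ 5 * N := H.le_sum_leafIndicator alg s₁ _ t₀ L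
  have hNle : N ≤ L := by
    have : ∀ t ∈ I, M₀.occupation alg s₁ t H.leafIndicator ≤ 1 := fun t _ => by
      have := M₀.occupation_mono alg s₁ t H.leafIndicator_le_one
      rwa [M₀.occupation_state alg s₁ t fun _ => 1, M₀.stateMean_const] at this
    refine (Finset.sum_le_sum this).trans (le_of_eq ?_)
    simp [hI]
  have hsum : ∑ z ∈ H.leafPairs, n z = N := by
    rw [hN, Finset.sum_comm]
    refine Finset.sum_congr rfl fun t _ => ?_
    rw [← M₀.occupation_sum]
    congr 1
    funext x a
    exact H.sum_pairIndicator x a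
  obtain ⟨z, hz, hzn⟩ : ∃ z ∈ H.leafPairs, n z ≤ N / c := by
    refine Finset.exists_le_of_sum_le ?_ ?_
    · exact Finset.card_pos.1 (lt_of_lt_of_le two_pos H.two_le_card_leafPairs)
    · rw [hsum, Finset.sum_const, nsmul_eq_mul, mul_div_cancel₀ _ (by linarith)]
  rw [le_div_iff₀ (by linarith)] at hzn
  have hn0 : 0 ≤ n z := Finset.sum_nonneg fun t _ =>
    occupation_nonneg alg s₁ M₀ t (H.pairIndicator_nonneg z)
  refine ⟨z, hz, ?_⟩
  set M₁ := H.process fun t => if t ∈ I then some z else b t with hM₁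
  set f : Fin S → Fin A → ℝ := fun x a => H.leafIndicator x a + -1 * H.pairIndicator z x a with hf
  -- With `n z ≤ L / c` and `S * A ≤ 4 * c`, the constant 6400 gives `4 / 6400 = (1 / 40)²`. The
  -- change of measure then costs `2 / 40 = 1 / 20` per step.
  have hent : H.ε ^ 2 * H.D * n z ≤ (1 / 40) ^ 2 := by
    have hεD : 0 ≤ H.ε ^ 2 * H.D := mul_nonneg (sq_nonneg _) H.D_pos.le
    have h1 := mul_le_mul_of_nonneg_left (hzn.trans hNle) hεD
    have h2 : c * (1600 * (H.ε ^ 2 * H.D * n z)) ≤ c * 1 := by linarith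
    linarith [le_of_mul_le_mul_left h2 (by linarith)]
  have hcmp : ∀ t ∈ I, M₀.occupation alg s₁ t f - 1 / 20 ≤ M₁.occupation alg s₁ t f := by
    intro t ht
    have h1 := NonstationaryMDP.occupation_sub_le (M := M₀) (M' := M₁) alg s₁ (fun _ => rfl)
      (fun t s a u h => H.trans_eq_zero _ _ s a u h)
      (κ := fun t s a => if t ∈ I then H.ε ^ 2 * H.D * H.pairIndicator z s a else 0) ?_ t
      (f := f) ?_ ?_
    · have h2 : ∑ i ∈ Finset.range t, M₀.occupation alg s₁ i
          (fun s a => if i ∈ I then H.ε ^ 2 * H.D * H.pairIndicator z s a else 0)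
          ≤ H.ε ^ 2 * H.D * n z := by
        have h3 : ∀ i, M₀.occupation alg s₁ i
            (fun s a => if i ∈ I then H.ε ^ 2 * H.D * H.pairIndicator z s a else 0)
            = if i ∈ I then H.ε ^ 2 * H.D * M₀.occupation alg s₁ i (H.pairIndicator z)
              else 0 := fun i => by
          split_ifs
          · rw [M₀.occupation_smul]
          · rw [M₀.occupation_state alg s₁ i fun _ => 0, M₀.stateMean_const]
        simp only [h3]
        rw [Finset.sum_ite_mem, hn, Finset.mul_sum]
        exact Finset.sum_le_sum_of_subset_of_nonneg Finset.inter_subset_right fun i _ _ =>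
          mul_nonneg (mul_nonneg (sq_nonneg _) H.D_pos.le)
            (occupation_nonneg alg s₁ M₀ i (H.pairIndicator_nonneg z))
      have h4 := Real.sqrt_le_sqrt (h2.trans hent)
      rw [Real.sqrt_sq (by norm_num)] at h4
      linarith
    · intro i s a
      by_cases hi : i ∈ I
      · simp only [hM₀, hM₁, process, if_pos hi]
        exact H.relativeEntropy_trans_le z s a
      · simp only [hM₀, hM₁, process, if_neg hi]
        refine le_of_eq (Finset.sum_eq_zero fun u _ => ?_)
        by_cases h0 : ((H.mdp (b i)).trans s a u).toReal = 0
        · simp [h0]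
        · simp [div_self h0]
    · intro x a
      simp only [hf]
      linarith [H.pairIndicator_le z x a]
    · intro x a
      simp only [hf]
      linarith [H.pairIndicator_nonneg z x a, H.leafIndicator_le_one x a]
  have hsum₀ : ∑ t ∈ I, M₀.occupation alg s₁ t f = N - n z := by
    simp only [hf, M₀.occupation_add, M₀.occupation_smul, Finset.sum_add_distrib, hN, hn,
      ← Finset.mul_sum]
    ring
  have hsum₁ := Finset.sum_le_sum hcmp
  rw [Finset.sum_sub_distrib, hsum₀, Finset.sum_const, nsmul_eq_mul, hI, Nat.card_Ico,
    Nat.add_sub_cancel_left, ← hI] at hsum₁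
  have hgap : H.gap (some z) = fun x a => H.ε * H.hubBias * f x a := by
    funext x a
    exact H.gap_eq z x a
  rw [hgap]
  simp only [M₁.occupation_smul, ← Finset.mul_sum]
  refine mul_le_mul_of_nonneg_left ?_ (mul_nonneg H.ε_pos.le H.hubBias_pos.le)
  -- From `4 * D ≤ L` follows `N ≥ 3 * L / 20`; hence `N - n z - L / 20 ≥ 3 * L / 40 - 2 * L / 40 =
  -- L / 40`.
  have h2n : 2 * n z ≤ N := by nlinarith
  linarith

/-! ### Concatenation of the windows. -/

/-- The process whose special pair is `ζ j` in the `j`-th window of length `L`. -/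
def windowedMDP (L : ℕ) (ζ : ℕ → Fin S × Fin A) : NonstationaryMDP S A :=
  H.process fun t => some (ζ (t / L))

/-- Greedy choice: the pair of window `m` is selected against the learner facing the pairs already
fixed, and redefining the process there leaves the laws in earlier windows unchanged. -/
theorem exists_special_pairs (L : ℕ) (hL : 4 * H.D ≤ L)
    (hε : 6400 * (H.ε ^ 2 * H.D * L) ≤ (S : ℝ) * A) (m : ℕ) :
    ∃ ζ : ℕ → Fin S × Fin A, (∀ j, ζ j ∈ H.leafPairs) ∧ ∀ j < m,
      H.ε * H.hubBias * (L / 40) ≤ ∑ t ∈ Finset.Ico (j * L) (j * L + L),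
        (H.windowedMDP L ζ).occupation alg s₁ t (H.gap (some (ζ (t / L)))) := by
  have hL0 : 0 < L := by
    have : (0 : ℝ) < L := by linarith [H.D_pos]
    exact_mod_cast this
  have hdiv : ∀ {j t : ℕ}, t ∈ Finset.Ico (j * L) (j * L + L) ↔ t / L = j := fun {j t} => by
    rw [Finset.mem_Ico, Nat.div_eq_iff hL0]
    omega
  induction m with
  | zero =>
    obtain ⟨z, hz⟩ := Finset.card_pos.1 (lt_of_lt_of_le two_pos H.two_le_card_leafPairs)
    exact ⟨fun _ => z, fun _ => hz, fun j hj => absurd hj (Nat.not_lt_zero j)⟩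
  | succ m ih =>
    obtain ⟨ζ, hζ, hreg⟩ := ih
    obtain ⟨z, hz, hzreg⟩ := H.exists_special_pair alg s₁ (fun t => some (ζ (t / L))) (m * L) L
      hL hε
    refine ⟨Function.update ζ m z, fun j => ?_, fun j hj => ?_⟩
    · by_cases h : j = m
      · rw [h, Function.update_self]; exact hz
      · rw [Function.update_of_ne h]; exact hζ j
    rcases Nat.lt_succ_iff_lt_or_eq.1 hj with h | rfl
    · refine (hreg j h).trans (le_of_eq (Finset.sum_congr rfl fun t ht => ?_))
      have ht' := hdiv.1 ht
      rw [ht', Function.update_of_ne h.ne]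
      refine congrFun (NonstationaryMDP.occupation_congr alg s₁ t fun i hi => ?_) _
      have : i / L ≠ m := by
        have := Nat.div_le_div_right (c := L) hi.le
        omega
      simp only [windowedMDP, process, Function.update_of_ne this]
    · refine hzreg.trans (le_of_eq (Finset.sum_congr rfl fun t ht => ?_))
      have ht' := hdiv.1 ht
      rw [ht', Function.update_self]
      congr 2
      funext i
      simp only [hdiv]
      by_cases hi : i / L = j
      · rw [if_pos hi, hi, Function.update_self]
      · rw [if_neg hi, Function.update_of_ne hi]

theorem sum_range_mul (f : ℕ → ℝ) (m L : ℕ) : ∑ t ∈ Finset.range (m * L), f t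
    = ∑ j ∈ Finset.range m, ∑ t ∈ Finset.Ico (j * L) (j * L + L), f t := by
  induction m with
  | zero => simp
  | succ m ih =>
    rw [Finset.sum_range_succ, ← ih, Nat.succ_mul,
      Finset.sum_range_add_sum_Ico _ (Nat.le_add_right _ _)]

/-- The regret of the learner against the windowed process. -/
theorem exists_le_dynamicRegret (hs : ¬ H.IsHub s₁) (L T : ℕ) (hL : 4 * H.D ≤ L)
    (hLT : L ≤ T) (hε : 6400 * (H.ε ^ 2 * H.D * L) ≤ (S : ℝ) * A) :
    ∃ ζ : ℕ → Fin S × Fin A,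
      H.ε * H.D * T / 400 ≤ (H.windowedMDP L ζ).dynamicRegret alg s₁ T := by
  obtain ⟨ζ, hζ, hreg⟩ := H.exists_special_pairs alg s₁ L hL hε (T / L)
  refine ⟨ζ, ?_⟩
  have hL0 : 0 < L := by
    have : (0 : ℝ) < L := by linarith [H.D_pos]
    exact_mod_cast this
  -- The complete windows cover at least half of the horizon, and `hubBias ≥ D / 5`, whence `400 = 2
  -- * 5 * 40`. The remaining steps have nonnegative gaps and are dropped.
  have h1 : H.ε * H.D * T / 400 ≤ ((T / L : ℕ) : ℝ) * (H.ε * H.hubBias * (L / 40)) := by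
    have h2 : (T : ℝ) ≤ 2 * (((T / L : ℕ) : ℝ) * L) := by
      have h3 : T ≤ 2 * (T / L * L) := by
        have h4 := Nat.div_add_mod T L
        have h5 := Nat.mod_lt T hL0
        have h6 : 1 ≤ T / L := (Nat.one_le_div_iff hL0).2 hLT
        nlinarith
      exact_mod_cast h3
    have h7 := mul_le_mul H.D_le_hubBias h2 (Nat.cast_nonneg T)
      (by linarith [H.hubBias_pos])
    have h8 := mul_le_mul_of_nonneg_left h7 H.ε_pos.le
    linarith
  have hnn : ∀ t, 0 ≤ (H.windowedMDP L ζ).occupation alg s₁ t (H.gap (some (ζ (t / L)))) :=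
    fun t => occupation_nonneg alg s₁ _ t (H.gap_nonneg _)
  calc H.ε * H.D * T / 400 ≤ ((T / L : ℕ) : ℝ) * (H.ε * H.hubBias * (L / 40)) := h1
    _ = ∑ j ∈ Finset.range (T / L), H.ε * H.hubBias * (L / 40) := by simp
    _ ≤ ∑ j ∈ Finset.range (T / L), ∑ t ∈ Finset.Ico (j * L) (j * L + L),
        (H.windowedMDP L ζ).occupation alg s₁ t (H.gap (some (ζ (t / L)))) :=
      Finset.sum_le_sum fun j hj => hreg j (Finset.mem_range.1 hj)
    _ = ∑ t ∈ Finset.range (T / L * L),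
        (H.windowedMDP L ζ).occupation alg s₁ t (H.gap (some (ζ (t / L)))) :=
      (sum_range_mul _ _ _).symm
    _ ≤ ∑ t ∈ Finset.range T,
        (H.windowedMDP L ζ).occupation alg s₁ t (H.gap (some (ζ (t / L)))) :=
      Finset.sum_le_sum_of_subset_of_nonneg
        (Finset.range_subset_range.2 (Nat.div_mul_le_self T L)) fun t _ _ => hnn t
    _ ≤ ∑ t ∈ Finset.range T, (H.value - (H.windowedMDP L ζ).expectedReward alg s₁ t) :=
      H.sum_gap_le_sum_regret alg s₁ hs _ T
    _ ≤ (H.windowedMDP L ζ).dynamicRegret alg s₁ T :=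
      Finset.sum_le_sum fun t _ => sub_le_sub_right
        (H.value_le_optimalGain (H.mem_leafPairs.1 (hζ (t / L))) _ s₁) _

theorem rewardVariation_windowedMDP (L T : ℕ) (ζ : ℕ → Fin S × Fin A) :
    (H.windowedMDP L ζ).rewardVariation T = 0 := by
  have : ∀ t x a, (H.windowedMDP L ζ (t + 1)).reward x a = (H.windowedMDP L ζ t).reward x a :=
    fun _ _ _ => rfl
  simp [NonstationaryMDP.rewardVariation, this]

/-- The kernel changes only where `t / L` jumps, by at most `2 * ε` each time; the jumps telescope
to their number. -/
theorem transVariation_windowedMDP_le (L T : ℕ) (ζ : ℕ → Fin S × Fin A) :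
    (H.windowedMDP L ζ).transVariation T ≤ 2 * H.ε * ((T - 1) / L : ℕ) := by
  have h : ∀ t, (⨆ x : Fin S × Fin A, ∑ s', |((H.windowedMDP L ζ (t + 1)).trans x.1 x.2 s').toReal
      - ((H.windowedMDP L ζ t).trans x.1 x.2 s').toReal|)
      ≤ 2 * H.ε * (((t + 1) / L : ℕ) - (t / L : ℕ) : ℝ) := fun t => by
    have hmono : t / L ≤ (t + 1) / L := Nat.div_le_div_right (Nat.le_succ t)
    have hmono' : ((t / L : ℕ) : ℝ) ≤ ((t + 1) / L : ℕ) := Nat.cast_le.2 hmono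
    refine Real.iSup_le (fun x => ?_) (mul_nonneg (by linarith [H.ε_pos]) (by linarith))
    by_cases heq : (t + 1) / L = t / L
    · simp only [windowedMDP, process, heq]
      simp
    · simp only [windowedMDP, process, trans_toReal]
      refine (H.sum_abs_weight_sub_le _ _ _ _).trans ?_
      have h1 : t / L + 1 ≤ (t + 1) / L := lt_of_le_of_ne hmono (Ne.symm heq)
      have h2 : ((t / L : ℕ) : ℝ) + 1 ≤ ((t + 1) / L : ℕ) := by exact_mod_cast h1
      nlinarith [H.ε_pos]
  refine (Finset.sum_le_sum fun t _ => h t).trans ?_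
  rw [← Finset.mul_sum, Finset.sum_range_sub fun t => ((t / L : ℕ) : ℝ)]
  simp

end HubTree

/-! ### Choice of the parameters. -/

/-- The depth is at most `1 + log_A S`; each of the two hypotheses on `D` absorbs one term into `D /
2`. -/
theorem ten_mul_heapDepth_le {S A : ℕ} {D : ℝ} (hA : 2 ≤ A) (hD : 20 ≤ D)
    (hDS : 20 * Real.logb A S ≤ D) : 10 * (heapDepth A (S - 2) : ℝ) ≤ D := by
  rcases h : S - 2 with _ | i
  · rw [heapDepth_zero]
    simp only [Nat.cast_zero, mul_zero]
    linarith
  have hA1 : (1 : ℝ) < A := by exact_mod_cast hA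
  have hS0 : (0 : ℝ) < S := by
    have : 0 < S := by omega
    exact_mod_cast this
  have h1 : (A : ℝ) ^ heapDepth A (i + 1) ≤ A * S := by
    have h2 : A ^ heapDepth A (i + 1) ≤ A * S :=
      (pow_heapDepth_le i).trans (Nat.mul_le_mul_left A (by omega))
    exact_mod_cast h2
  have h3 := Real.logb_le_logb_of_le hA1 (by positivity) h1
  rw [Real.logb_pow, Real.logb_self_eq_one hA1, mul_one,
    Real.logb_mul (by positivity) hS0.ne', Real.logb_self_eq_one hA1] at h3
  linarith

/-- The choice of the window length. -/
theorem exists_windowLength {T : ℕ} {D B K X : ℝ} (hD : 1 ≤ D) (hK : 1 ≤ K)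
    (hX : 0 ≤ X) (hX3 : X ^ 3 = D ^ 2 * B * K * T ^ 2) (hT : D * K ≤ T)
    (hBT : B * D ^ 2 * K ≤ T) :
    ∃ L : ℕ, D * K ≤ L ∧ L ≤ T ∧ X ^ 2 * L ≤ 2 * (D * K * T ^ 2) ∧
      (L = T ∨ K * T ^ 2 ≤ B ^ 2 * D * L ^ 3) := by
  have hDK : 1 ≤ D * K := one_le_mul_of_one_le_of_one_le hD hK
  have hT0 : (0 : ℝ) < T := by linarith
  -- Here `X` is the target rate. In this case the stationary rate `√(D * K * T)` already dominates
  -- it, and one window is enough.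
  by_cases hcase : X ^ 2 ≤ D * K * T
  · refine ⟨T, hT, le_rfl, ?_, Or.inl rfl⟩
    have := mul_le_mul_of_nonneg_right hcase hT0.le
    nlinarith [mul_nonneg (by linarith : 0 ≤ D * K) (sq_nonneg (T : ℝ))]
  · push Not at hcase
    have hX2 : 0 < X ^ 2 := lt_trans (by positivity) hcase
    have hX0 : 0 < X := by
      rcases hX.eq_or_lt with h | h
      · rw [← h] at hX2; norm_num at hX2
      · exact h
    have hXT : X ≤ T := by
      refine le_of_pow_le_pow_left₀ (n := 3) (by norm_num) hT0.le ?_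
      rw [hX3]
      nlinarith [mul_le_mul_of_nonneg_right hBT (sq_nonneg (T : ℝ))]
    -- The solution of `T * √(D * K / Λ) = X`. It also satisfies `K * T² = B² * D * Λ³`, which
    -- saturates the budget up to constants; `X ≤ T` gives `Λ ≥ D * K ≥ 1`, so rounding up at most
    -- doubles it.
    set Λ : ℝ := D * K * T ^ 2 / X ^ 2 with hΛ
    have hΛX : Λ * X ^ 2 = D * K * T ^ 2 := div_mul_cancel₀ _ hX2.ne'
    have hΛT : Λ ≤ T := by
      rw [hΛ, div_le_iff₀ hX2]
      nlinarith [mul_le_mul_of_nonneg_left hcase.le hT0.le]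
    have hΛge : D * K ≤ Λ := by
      rw [hΛ, le_div_iff₀ hX2]
      exact mul_le_mul_of_nonneg_left (pow_le_pow_left₀ hX hXT 2) (by linarith)
    have hL := Nat.le_ceil Λ
    have hL' := (Nat.ceil_lt_add_one (by linarith : 0 ≤ Λ)).le
    refine ⟨⌈Λ⌉₊, hΛge.trans hL, Nat.ceil_le.2 hΛT, ?_, Or.inr ?_⟩
    · have : X ^ 2 * (⌈Λ⌉₊ : ℝ) ≤ X ^ 2 * (2 * Λ) :=
        mul_le_mul_of_nonneg_left (by linarith) hX2.le
      linarith
    · have h1 : K * (T : ℝ) ^ 2 = B ^ 2 * D * Λ ^ 3 := by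
        have h2 : (K * (T : ℝ) ^ 2) * (X ^ 3) ^ 2 = (B ^ 2 * D * Λ ^ 3) * (X ^ 3) ^ 2 := by
          calc (K * (T : ℝ) ^ 2) * (X ^ 3) ^ 2 = B ^ 2 * D * (D * K * T ^ 2) ^ 3 := by
                rw [hX3]; ring
            _ = (B ^ 2 * D * Λ ^ 3) * (X ^ 3) ^ 2 := by rw [← hΛX]; ring
        exact mul_right_cancel₀ (by positivity) h2
      rw [h1]
      gcongr

end

theorem mainTheorem6 :
    ∃ c : ℝ, 0 < c ∧
      ∀ (S A T : ℕ) (D B : ℝ), 2 ≤ S → 2 ≤ A →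
        20 ≤ D → 20 * Real.logb (A : ℝ) (S : ℝ) ≤ D → 0 ≤ B →
        D * (S : ℝ) * (A : ℝ) ≤ (T : ℝ) →
        B * D ^ 2 * (S : ℝ) * (A : ℝ) ≤ (T : ℝ) →
        ∀ (alg : LearningAlgorithm S A) (s₁ : Fin S),
          ∃ M : NonstationaryMDP S A,
            (∀ t, (M t).diameter = ENNReal.ofReal D) ∧
            M.rewardVariation T = 0 ∧
            M.transVariation T ≤ B ∧
            c * (D ^ (2 / 3 : ℝ) * B ^ (1 / 3 : ℝ) * (S : ℝ) ^ (1 / 3 : ℝ) *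
              (A : ℝ) ^ (1 / 3 : ℝ) * (T : ℝ) ^ (2 / 3 : ℝ)) ≤
              M.dynamicRegret alg s₁ T := by
  -- `48000 = 120 * 400`, with 400 from `exists_le_dynamicRegret` and 120 from the comparison of `X`
  -- with `ε * D * T`: `120² / 6400 = 2.25` exceeds the factor 2 lost in rounding the window length.
  refine ⟨1 / 48000, by norm_num, ?_⟩
  intro S A T D B hS hA hD hDS hB hT hBT alg s₁
  set X : ℝ := D ^ (2 / 3 : ℝ) * B ^ (1 / 3 : ℝ) * (S : ℝ) ^ (1 / 3 : ℝ) *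
    (A : ℝ) ^ (1 / 3 : ℝ) * (T : ℝ) ^ (2 / 3 : ℝ) with hX
  set K : ℝ := (S : ℝ) * A with hK
  have hS' : (2 : ℝ) ≤ S := by exact_mod_cast hS
  have hA' : (2 : ℝ) ≤ A := by exact_mod_cast hA
  have hD0 : 0 < D := by linarith
  have hK4 : 4 ≤ K := by nlinarith
  have hX0 : 0 ≤ X := by positivity
  have hX3 : X ^ 3 = D ^ 2 * B * K * T ^ 2 := by
    have h1 : ∀ {x : ℝ}, 0 ≤ x → (x ^ (1 / 3 : ℝ)) ^ 3 = x := fun {x} hx => by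
      rw [← Real.rpow_natCast, ← Real.rpow_mul hx]
      norm_num
    have h2 : ∀ {x : ℝ}, 0 ≤ x → (x ^ (2 / 3 : ℝ)) ^ 3 = x ^ 2 := fun {x} hx => by
      rw [← Real.rpow_natCast, ← Real.rpow_mul hx, ← Real.rpow_natCast]
      norm_num
    rw [hX, mul_pow, mul_pow, mul_pow, mul_pow, h2 hD0.le, h1 hB, h1 (Nat.cast_nonneg S),
      h1 (Nat.cast_nonneg A), h2 (Nat.cast_nonneg T)]
    ring
  rw [mul_assoc] at hT
  rw [mul_assoc (B * D ^ 2)] at hBT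
  obtain ⟨L, hDL, hLT, hXL, hvar⟩ := exists_windowLength (by linarith) (by linarith) hX0 hX3
    hT hBT
  have hDK : 4 * D ≤ D * K := by nlinarith
  have hL0 : (0 : ℝ) < L := by linarith
  -- The largest bonus that the information constraint of a window allows; `D * K ≤ L` makes `ε * D
  -- ≤ 1`.
  set ε : ℝ := √(K / (6400 * (D * L))) with hε
  have hε2 : ε ^ 2 = K / (6400 * (D * L)) := Real.sq_sqrt (by positivity)
  have hεL : 6400 * (ε ^ 2 * D * L) = K := by
    rw [hε2]
    field_simp
  have hε0 : 0 < ε := Real.sqrt_pos.2 (by positivity)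
  have hεD : ε * D ≤ 1 := by
    refine abs_le_of_sq_le_sq' ?_ zero_le_one |>.2
    have h1 : (ε * D) ^ 2 * (6400 * L) ≤ 1 ^ 2 * (6400 * L) := by
      have h2 : (ε * D) ^ 2 * (6400 * L) = D * K := by rw [← hεL]; ring
      linarith
    exact le_of_mul_le_mul_right h1 (by positivity)
  let H : HubTree S A :=
    -- The swap makes the arbitrary initial state the root, so the learner does not start in the
    -- hub.
    { pos := Equiv.swap s₁ ⟨0, by omega⟩
      D := D
      ε := ε
      two_le_S := hS
      two_le_A := hA
      le_D := hD
      depth_le := ten_mul_heapDepth_le hA hD hDS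
      ε_pos := hε0
      ε_mul_le := hεD }
  have hs : ¬ H.IsHub s₁ := by
    simp only [HubTree.IsHub, H, Equiv.swap_apply_left]
    omega
  obtain ⟨ζ, hζ⟩ := H.exists_le_dynamicRegret alg s₁ hs L T (hDK.trans hDL) hLT hεL.le
  refine ⟨H.windowedMDP L ζ, fun t => H.diameter_mdp _, H.rewardVariation_windowedMDP L T ζ,
    (H.transVariation_windowedMDP_le L T ζ).trans ?_, le_trans ?_ hζ⟩
  · change 2 * ε * ((T - 1) / L : ℕ) ≤ B
    -- If `L = T` there is no boundary between the first and the last step, as `(T - 1) / T = 0`,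
    -- and the variation is zero for any `B ≥ 0`.
    rcases hvar with rfl | hvar
    · rw [Nat.div_eq_of_lt]
      · simpa using hB
      · have : 0 < L := by exact_mod_cast hL0
        omega
    · have h1 : (((T - 1) / L : ℕ) : ℝ) ≤ T / L :=
        (Nat.cast_div_le).trans (by gcongr; omega)
      refine (mul_le_mul_of_nonneg_left h1 (by positivity)).trans ?_
      rw [← mul_div_assoc, div_le_iff₀ hL0]
      refine abs_le_of_sq_le_sq' ?_ (by positivity) |>.2
      have h2 : 6400 * ((2 * ε * T) ^ 2 * (D * L)) = 4 * (K * T ^ 2) := by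
        rw [← hεL]; ring
      have h3 : (2 * ε * T) ^ 2 * (D * L) ≤ (B * L) ^ 2 * (D * L) := by
        have h4 : (0 : ℝ) ≤ K * T ^ 2 := by positivity
        have h5 : (B * L) ^ 2 * (D * L) = B ^ 2 * D * L ^ 3 := by ring
        linarith
      exact le_of_mul_le_mul_right h3 (by positivity)
  · change 1 / 48000 * X ≤ ε * D * T / 400
    have h1 : X ≤ 120 * (ε * D * T) := by
      refine abs_le_of_sq_le_sq' ?_ (by positivity) |>.2
      have h2 : X ^ 2 * L ≤ (120 * (ε * D * T)) ^ 2 * L := by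
        have h3 : (120 * (ε * D * T)) ^ 2 * L = 14400 / 6400 * (D * K * T ^ 2) := by
          rw [← hεL]; ring
        have h4 : 0 ≤ D * K * (T : ℝ) ^ 2 := by positivity
        linarith
      exact le_of_mul_le_mul_right h2 hL0
    linarith
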